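/- **Notation.** Let $\mathbb D$ be the open unit disc and $\mathcal H(\mathbb D)$ the space of analytic functions in $\mathbb D$. For $0<p<\infty$ and $0\le r<1$ let $M_p(r,f)=\big(\frac1{2\pi}\int_0^{2\pi}|f(re^{it})|^p\,dt\big)^{1/p}$ and $\|f\|_{H^p}=\sup_{0<r<1}M_p(r,f)$. A radial weight is a nonnegative integrable function $\omega$ on $\mathbb D$ with $\omega(z)=\omega(|z|)$; put $\widehat\omega(r)=\int_r^1\omega(s)\,ds$. Write $\omega\in\widehat{\mathcal D}$ if $\omega$ is a radial weight, $\widehat\omega(0)<\infty$, and there is $C\ge1$ with $\widehat\omega(r)\le C\,\widehat\omega\big(\frac{1+r}2\big)$ for all $0\le r<1$. For $0<q,\beta<\infty$ set $$\|f\|_{H(p,q,\omega)}=\Big(\int_0^1M_p(r,f)^q\,\omega(r)\,dr\Big)^{1/q},\qquad \|f\|_{H(p,\infty,\widehat\omega^\beta)}=\sup_{0<r<1}M_p(r,f)\,\widehat\omega(r)^\beta,$$ and let $H(p,q,\omega)$, $H(p,\infty,\widehat\omega^\beta)$ be the sets of $f\in\mathcal H(\mathbb D)$ for which the respective quantity is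 finite. Let $\alpha>0$ and $\int_0^1\omega(r)\,dr=1$, and for $n=0,1,2,\dots$ let $r_n\in[0,1)$ be any point with $\widehat\omega(r_n)=2^{-n\alpha}$. Put $M_n=\big\lfloor\frac1{1-r_n}\big\rfloor$, $I(0)=\{k\ge0:k<M_1\}$, and $I(n)=\{k:M_n\le k<M_{n+1}\}$ for $n\ge1$. For $f(z)=\sum_{k\ge0}a_kz^k\in\mathcal H(\mathbb D)$ put $\Delta_nf(z)=\sum_{k\in I(n)}a_kz^k$. **Theorem.** Let $1<p<\infty$, $0<\alpha<\infty$, and let $\omega\in\widehat{\mathcal D}$ with $\int_0^1\omega(r)\,dr=1$. (i) If $0<q<\infty$, then $f\in\mathcal H(\mathbb D)$ belongs to $H(p,q,\omega)$ if and only if $\sum_{n=0}^\infty2^{-n\alpha}\|\Delta_nf\|_{H^p}^q<\infty$. Moreover, there is a constant $C=C(p,q,\alpha,\omega)>0$ such that for every choice of the points $r_n$ and every $f\in\mathcal H(\mathbb D)$ $$C^{-1}\|f\|_{H(p,q,\omega)}\le\Big(\sum_{n=0}^\infty2^{-n\alpha}\|\Delta_nf\|_{H^p}^q\Big)^{1/q}\le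 C\,\|f\|_{H(p,q,\omega)}.$$ (ii) If $0<\beta<\infty$, then $f\in\mathcal H(\mathbb D)$ belongs to $H(p,\infty,\widehat\omega^\beta)$ if and only if $\sup_n2^{-n\alpha\beta}\|\Delta_nf\|_{H^p}<\infty$. Moreover, there is a constant $C=C(p,\alpha,\beta,\omega)>0$ such that for every choice of the points $r_n$ and every $f\in\mathcal H(\mathbb D)$ $$C^{-1}\|f\|_{H(p,\infty,\widehat\omega^\beta)}\le\sup_n2^{-n\alpha\beta}\|\Delta_nf\|_{H^p}\le C\,\|f\|_{H(p,\infty,\widehat\omega^\beta)}.$$ Here all quantities may take the value $\infty$. -/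

import Mathlib

open MeasureTheory
open scoped ENNReal NNReal

noncomputable section

namespace MixedNorm

/-- `f` is analytic in the unit disc; values of `f` outside the disc play no role. -/
def IsAnalyticDisc (f : ℂ → ℂ) : Prop :=
  DifferentiableOn ℂ f (Metric.ball 0 1)

/-- A radial weight: a nonnegative integrable function on the unit disc with `ω(z) = ω(|z|)`. -/
structure IsRadialWeight (ω : ℂ → ℝ) : Prop where
  nonneg : ∀ z ∈ Metric.ball (0 : ℂ) 1, 0 ≤ ω z
  integrable : IntegrableOn ω (Metric.ball 0 1)
  radial : ∀ z ∈ Metric.ball (0 : ℂ) 1, ω z = ω (‖z‖ : ℂ)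

/-- The tail integral `ω̂(r) = ∫_r^1 ω(s) ds`. -/
def tail (ω : ℂ → ℝ) (r : ℝ) : ℝ := ∫ s in r..1, ω (s : ℂ)

/-- The class `D̂` of radial weights whose tail integral is (finite and) doubling. -/
structure IsDoublingWeight (ω : ℂ → ℝ) : Prop extends IsRadialWeight ω where
  tail_finite : IntervalIntegrable (fun s : ℝ => ω (s : ℂ)) volume 0 1
  doubling : ∃ C : ℝ, 1 ≤ C ∧ ∀ r : ℝ, 0 ≤ r → r < 1 → tail ω r ≤ C * tail ω ((1 + r) / 2)

/-- The integral mean `M_p(r, f) = ((1 / 2π) ∫_0^{2π} |f(r e^{it})|^p dt)^{1/p}`. -/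
def integralMean (p r : ℝ) (f : ℂ → ℂ) : ℝ≥0∞ :=
  (ENNReal.ofReal (2 * Real.pi)⁻¹ *
    ∫⁻ t in Set.Ioc 0 (2 * Real.pi), ‖f (circleMap 0 r t)‖ₑ ^ p) ^ (1 / p)

/-- The Hardy space norm `‖f‖_{H^p} = sup_{0 < r < 1} M_p(r, f)`. -/
def hardyNorm (p : ℝ) (f : ℂ → ℂ) : ℝ≥0∞ :=
  ⨆ r ∈ Set.Ioo (0 : ℝ) 1, integralMean p r f

/-- The norm of `H(p, q, ω)`: `(∫_0^1 M_p(r, f)^q ω(r) dr)^{1/q}`. -/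
def mixedNorm (p q : ℝ) (ω : ℂ → ℝ) (f : ℂ → ℂ) : ℝ≥0∞ :=
  (∫⁻ r in Set.Ioo (0 : ℝ) 1, integralMean p r f ^ q * ENNReal.ofReal (ω (r : ℂ))) ^ (1 / q)

/-- The mixed norm space `H(p, q, ω)`. -/
def MixedNormSpace (p q : ℝ) (ω : ℂ → ℝ) : Set (ℂ → ℂ) :=
  {f | IsAnalyticDisc f ∧ mixedNorm p q ω f < ∞}

/-- The norm of `H(p, ∞, ω̂^β)`: `sup_{0 < r < 1} M_p(r, f) ω̂(r)^β`. -/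
def mixedSupNorm (p β : ℝ) (ω : ℂ → ℝ) (f : ℂ → ℂ) : ℝ≥0∞ :=
  ⨆ r ∈ Set.Ioo (0 : ℝ) 1, integralMean p r f * ENNReal.ofReal (tail ω r ^ β)

/-- The mixed norm space `H(p, ∞, ω̂^β)`. -/
def MixedSupNormSpace (p β : ℝ) (ω : ℂ → ℝ) : Set (ℂ → ℂ) :=
  {f | IsAnalyticDisc f ∧ mixedSupNorm p β ω f < ∞}

/-- `r_0, r_1, …` are points of `[0, 1)` with `ω̂(r_n) = 2^{-nα}`. (They are determined by `ω` and
`α` up to intervals on which `ω` vanishes almost everywhere.) -/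
def IsDyadicPoints (ω : ℂ → ℝ) (α : ℝ) (r : ℕ → ℝ) : Prop :=
  ∀ n : ℕ, r n ∈ Set.Ico (0 : ℝ) 1 ∧ tail ω (r n) = (2 : ℝ) ^ (-(n * α))

/-- Such points exist for every radial weight with `∫_0^1 ω = 1`. -/
theorem exists_isDyadicPoints {ω : ℂ → ℝ} {α : ℝ} (hα : 0 < α) (h : tail ω 0 = 1) :
    ∃ r : ℕ → ℝ, IsDyadicPoints ω α r := by
  have hint : IntervalIntegrable (fun s : ℝ => ω (s : ℂ)) volume 0 1 := by
    by_contra hc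
    have := intervalIntegral.integral_undef hc
    unfold tail at h
    linarith
  have hcont : ContinuousOn (tail ω) (Set.Icc 0 1) := by
    have := intervalIntegral.continuousOn_primitive_interval_left
      (f := fun s : ℝ => ω (s : ℂ)) (μ := volume) (a := 0) (b := 1)
      (by rw [Set.uIcc_of_le zero_le_one, integrableOn_Icc_iff_integrableOn_Ioc]
          exact (intervalIntegrable_iff_integrableOn_Ioc_of_le zero_le_one).1 hint)
    rwa [Set.uIcc_of_le zero_le_one] at this
  have h1 : tail ω 1 = 0 := by simp [tail]
  have key : ∀ n : ℕ, ∃ x : ℝ, x ∈ Set.Ico (0 : ℝ) 1 ∧ tail ω x = (2 : ℝ) ^ (-(n * α)) := by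
    intro n
    have hpos : (0 : ℝ) < (2 : ℝ) ^ (-(n * α)) := by positivity
    have hle : (2 : ℝ) ^ (-(n * α)) ≤ 1 :=
      Real.rpow_le_one_of_one_le_of_nonpos (by norm_num) (neg_nonpos.2 (by positivity))
    obtain ⟨x, hx, hxe⟩ := intermediate_value_Icc' zero_le_one hcont
      (show (2 : ℝ) ^ (-(n * α)) ∈ Set.Icc (tail ω 1) (tail ω 0) by
        rw [h, h1]; exact ⟨hpos.le, hle⟩)
    refine ⟨x, ⟨hx.1, lt_of_le_of_ne hx.2 ?_⟩, hxe⟩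
    rintro rfl
    rw [h1] at hxe
    exact hpos.ne hxe
  choose r hr using key
  exact ⟨r, hr⟩

/-- `M_n`, the integer part of `1 / (1 - r_n)`. -/
def blockIndex (r : ℕ → ℝ) (n : ℕ) : ℕ := ⌊1 / (1 - r n)⌋₊

/-- `I(0) = {k : k < M_1}` and `I(n) = {k : M_n ≤ k < M_{n+1}}` for `n ≥ 1`. -/
def block (r : ℕ → ℝ) (n : ℕ) : Finset ℕ :=
  if n = 0 then Finset.range (blockIndex r 1)
  else Finset.Ico (blockIndex r n) (blockIndex r (n + 1))

/-- The Taylor coefficient `a_k = f^{(k)}(0) / k!`. -/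
def taylorCoeff (f : ℂ → ℂ) (k : ℕ) : ℂ := iteratedDeriv k f 0 / (k.factorial : ℂ)

/-- The block `Δ_n f(z) = ∑_{k ∈ I(n)} a_k z^k` of the Taylor series of `f`. -/
def dyadicBlock (r : ℕ → ℝ) (n : ℕ) (f : ℂ → ℂ) (z : ℂ) : ℂ :=
  ∑ k ∈ block r n, taylorCoeff f k * z ^ k

/-- `∑_n 2^{-nα} ‖Δ_n f‖_{H^p}^q`. -/
def blockSum (p q α : ℝ) (r : ℕ → ℝ) (f : ℂ → ℂ) : ℝ≥0∞ :=
  ∑' n : ℕ, ENNReal.ofReal ((2 : ℝ) ^ (-(n * α))) * hardyNorm p (dyadicBlock r n f) ^ q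

/-- `sup_n 2^{-nαβ} ‖Δ_n f‖_{H^p}`. -/
def blockSup (p α β : ℝ) (r : ℕ → ℝ) (f : ℂ → ℂ) : ℝ≥0∞ :=
  ⨆ n : ℕ, ENNReal.ofReal ((2 : ℝ) ^ (-(n * α * β))) * hardyNorm p (dyadicBlock r n f)

end MixedNorm

end

/-! By monotonicity of `M_p(r, f)` in `r`, the norms discretize. Between consecutive points `r_n`
the weight has mass comparable to `2^{-nα}`, so the `q`-th power of the `H(p,q,ω)` norm is
comparable to `∑ 2^{-nα} M_p(r_{n+1}, f)^q`, and the supremum norm to `sup 2^{-nαβ} M_p(r_{n+1},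
f)`. It remains to compare the means at `r_{n+1}` with the block norms.

Blocks by means: `Δ_n f` has degree below `M_{n+1} ≤ 1/(1 - r_{n+1})`, so passing from the unit
circle to radius `r_{n+1}` costs at most a factor `e` (`inv_pow_floor_sub_one_le`), and cutting the
block out of `f` costs a constant by M. Riesz's theorem (`exists_circleInt_partialSum_le`). This is
where `p > 1` is essential.

Means by blocks: `Δ_k f` is divisible by `z^{M_k}`, hence `M_p(r_{n+1}, f) ≤ ∑_k r_{n+1}^{M_k} ‖Δ_k
f‖`. Doubling of the tail makes `(1 - r_{n+1})/(1 - r_k)` grow at least geometrically in `k - n`, so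
`r_{n+1}^{M_k}` decays faster than any prescribed geometric sequence (`exists_pow_blockStart_le`).
After weighting, the sum is a convolution with a two-sided geometric sequence, which is bounded on
`ℓ^q` for every `q > 0` and on `ℓ^∞`.

Both function-theoretic inputs, monotone means and M. Riesz's inequality, come from one principle:
circular means of `Φ ∘ f` increase with the radius when `Φ` is subharmonic. It is applied to
polynomials only, and the results pass to `f` through its Taylor sums. All constants are chosen
before the points `r_n` and the function `f`. -/

noncomputable section

namespace MixedNorm

/-! ### Integral means of subharmonic functions of entire functions -/

/-- Differentiation under the integral sign, for a jointly continuous derivative. -/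
theorem hasDerivAt_intervalIntegral_of_continuous {H H' : ℝ → ℝ → ℝ} {a b : ℝ}
    (hH : Continuous (Function.uncurry H)) (hH' : Continuous (Function.uncurry H'))
    (hd : ∀ x t, HasDerivAt (fun y => H y t) (H' x t) x) (x₀ : ℝ) :
    HasDerivAt (fun x => ∫ t in a..b, H x t) (∫ t in a..b, H' x₀ t) x₀ := by
  obtain ⟨B, hB⟩ := ((isCompact_closedBall x₀ 1).prod
    (isCompact_uIcc (a := a) (b := b))).exists_bound_of_continuousOn hH'.continuousOn
  have hc : ∀ x, Continuous (H x) := fun x => hH.comp (Continuous.prodMk_right x)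
  have hc' : ∀ x, Continuous (H' x) := fun x => hH'.comp (Continuous.prodMk_right x)
  refine (intervalIntegral.hasDerivAt_integral_of_dominated_loc_of_deriv_le
    (F := H) (F' := H') (bound := fun _ => B) (Metric.closedBall_mem_nhds x₀ one_pos)
    (Filter.Eventually.of_forall fun x => (hc x).aestronglyMeasurable)
    ((hc x₀).intervalIntegrable _ _) (hc' x₀).aestronglyMeasurable ?_ (by simp) ?_).2
  · exact Filter.Eventually.of_forall fun t ht x hx =>
      hB (x, t) ⟨hx, Set.uIoc_subset_uIcc ht⟩
  · exact Filter.Eventually.of_forall fun t _ x _ => hd x t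

/-- Multiplication by `w` is a rotation scaled by `‖w‖`, and the trace is rotation invariant.
Applied to the Hessian of `Φ`, this is the identity `Δ(Φ ∘ f) = |f'|² (ΔΦ) ∘ f`. -/
theorem bilin_add_bilin_I (T : ℂ →L[ℝ] ℂ →L[ℝ] ℝ) (hT : ∀ v w, T v w = T w v) (w : ℂ) :
    T w w + T (Complex.I * w) (Complex.I * w) =
      ‖w‖ ^ 2 * (T 1 1 + T Complex.I Complex.I) := by
  have h1 : w = w.re • (1 : ℂ) + w.im • Complex.I := by
    apply Complex.ext <;> simp
  have h2 : Complex.I * w = (-w.im) • (1 : ℂ) + w.re • Complex.I := by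
    apply Complex.ext <;> simp
  rw [h2, Complex.sq_norm, Complex.normSq_apply]
  nth_rewrite 1 [h1]
  nth_rewrite 3 [h1]
  simp only [map_add, map_smul, add_apply, smul_apply, smul_eq_mul, hT Complex.I 1]
  ring

/-- A function of class `C²` on the plane with nonnegative Laplacian. -/
def IsC2Subharmonic (Φ : ℂ → ℝ) : Prop :=
  ContDiff ℝ 2 Φ ∧ ∀ z, 0 ≤ fderiv ℝ (fderiv ℝ Φ) z 1 1 +
    fderiv ℝ (fderiv ℝ Φ) z Complex.I Complex.I

/-- If `Φ` is subharmonic of class `C²` and `f` is entire, then the circular means of `Φ ∘ f`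
increase with the radius. -/
theorem monotoneOn_integral_comp_circleMap {Φ : ℂ → ℝ} (h : IsC2Subharmonic Φ)
    {f : ℂ → ℂ} (hf : Differentiable ℂ f) :
    MonotoneOn (fun r : ℝ => ∫ t in (0 : ℝ)..(2 * Real.pi), Φ (f (circleMap 0 r t)))
      (Set.Ici 0) := by
  obtain ⟨hΦ, hlap⟩ := h
  have hentire : ∀ {u : ℂ → ℂ}, Differentiable ℂ u → Differentiable ℂ (deriv u) := by
    intro u hu
    exact (hu.contDiff (n := 2)).differentiable_deriv_two
  -- With `g = z f'`, the polar derivatives of `f` are `r ∂_r f = g` and `∂_t f = i g`.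
  set g : ℂ → ℂ := fun z => z * deriv f z with hg
  have hgd : Differentiable ℂ g := differentiable_id.mul (hentire hf)
  have hD1 : ContDiff ℝ 1 (fderiv ℝ Φ) := hΦ.fderiv_right (m := 1) (by norm_num)
  have hΦd : ∀ z, HasFDerivAt Φ (fderiv ℝ Φ z) z := fun z =>
    (hΦ.differentiable (by norm_num) z).hasFDerivAt
  have hDd : ∀ z, HasFDerivAt (fderiv ℝ Φ) (fderiv ℝ (fderiv ℝ Φ) z) z := fun z =>
    (hD1.differentiable (by norm_num) z).hasFDerivAt
  have hDc : Continuous (fderiv ℝ Φ) := hD1.continuous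
  have hD2c : Continuous (fderiv ℝ (fderiv ℝ Φ)) := hD1.continuous_fderiv (by norm_num)
  have hsymm : ∀ z v w, fderiv ℝ (fderiv ℝ Φ) z v w = fderiv ℝ (fderiv ℝ Φ) z w v := by
    intro z v w
    exact second_derivative_symmetric (fun y => hΦd y) (hDd z) v w
  set e : ℝ → ℂ := fun t => Complex.exp (t * Complex.I) with he
  have hec : Continuous e := by fun_prop
  have hzr : ∀ r t : ℝ, HasDerivAt (fun y : ℝ => circleMap 0 y t) (e t) r := by
    intro r t
    have : HasDerivAt (fun y : ℝ => 0 + (y : ℂ) * e t) (1 * e t) r :=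
      ((Complex.ofRealCLM.hasDerivAt (x := r)).mul_const (e t)).const_add 0
    simpa [circleMap, he] using this
  have hzc : Continuous fun q : ℝ × ℝ => circleMap 0 q.1 q.2 := by
    unfold circleMap; fun_prop
  have hcomp : ∀ {u : ℂ → ℂ}, Differentiable ℂ u → ∀ {z : ℝ → ℂ} {z' : ℂ} {s : ℝ},
      HasDerivAt z z' s → HasDerivAt (fun y => u (z y)) (deriv u (z s) * z') s := by
    intro u hu z z' s hz
    exact (hu (z s)).hasDerivAt.comp s hz
  have hfc := hf.continuous
  have hgc := hgd.continuous
  have hf'c := (hentire hf).continuous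
  have hg'c := (hentire hgd).continuous
  -- the radial derivative
  set H' : ℝ → ℝ → ℝ := fun r t =>
    fderiv ℝ Φ (f (circleMap 0 r t)) (deriv f (circleMap 0 r t) * e t) with hH'
  set K : ℝ → ℝ → ℝ := fun r t => fderiv ℝ Φ (f (circleMap 0 r t)) (g (circleMap 0 r t)) with hK
  set K' : ℝ → ℝ → ℝ := fun r t =>
    fderiv ℝ (fderiv ℝ Φ) (f (circleMap 0 r t)) (deriv f (circleMap 0 r t) * e t)
      (g (circleMap 0 r t)) +
    fderiv ℝ Φ (f (circleMap 0 r t)) (deriv g (circleMap 0 r t) * e t) with hK'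
  have hKH : ∀ r t, K r t = r * H' r t := by
    intro r t
    have : g (circleMap 0 r t) = r • (deriv f (circleMap 0 r t) * e t) := by
      simp only [hg, circleMap, he, Complex.real_smul]; ring
    simp only [hK, hH', this, map_smul, smul_eq_mul]
  have hm : ∀ r, HasDerivAt (fun r => ∫ t in (0 : ℝ)..(2 * Real.pi), Φ (f (circleMap 0 r t)))
      (∫ t in (0 : ℝ)..(2 * Real.pi), H' r t) r := by
    refine hasDerivAt_intervalIntegral_of_continuous (H := fun r t => Φ (f (circleMap 0 r t)))
      ?_ ?_ ?_
    · exact hΦ.continuous.comp (hfc.comp hzc)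
    · exact (hDc.comp (hfc.comp hzc)).clm_apply ((hf'c.comp hzc).mul (hec.comp continuous_snd))
    · intro r t
      exact (hΦd _).comp_hasDerivAt r (hcomp hf (hzr r t))
  have hk : ∀ r, HasDerivAt (fun r => ∫ t in (0 : ℝ)..(2 * Real.pi), K r t)
      (∫ t in (0 : ℝ)..(2 * Real.pi), K' r t) r := by
    refine hasDerivAt_intervalIntegral_of_continuous ?_ ?_ ?_
    · exact (hDc.comp (hfc.comp hzc)).clm_apply (hgc.comp hzc)
    · exact (((hD2c.comp (hfc.comp hzc)).clm_apply
        ((hf'c.comp hzc).mul (hec.comp continuous_snd))).clm_apply (hgc.comp hzc)).add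
        ((hDc.comp (hfc.comp hzc)).clm_apply ((hg'c.comp hzc).mul (hec.comp continuous_snd)))
    · intro r t
      exact ((hDd _).comp_hasDerivAt r (hcomp hf (hzr r t))).clm_apply (hcomp hgd (hzr r t))
  -- the angular second derivative integrates to zero
  have hang : ∀ r : ℝ, ∫ t in (0 : ℝ)..(2 * Real.pi),
      (fderiv ℝ (fderiv ℝ Φ) (f (circleMap 0 r t)) (Complex.I * g (circleMap 0 r t))
        (Complex.I * g (circleMap 0 r t)) -
      fderiv ℝ Φ (f (circleMap 0 r t)) (circleMap 0 r t * deriv g (circleMap 0 r t))) = 0 := by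
    intro r
    have hzt : ∀ t, HasDerivAt (fun s : ℝ => circleMap 0 r s) (circleMap 0 r t * Complex.I) t :=
      fun t => hasDerivAt_circleMap 0 r t
    have hzc' : Continuous fun t : ℝ => circleMap 0 r t := continuous_circleMap 0 r
    rw [intervalIntegral.integral_eq_sub_of_hasDerivAt
      (f := fun t => fderiv ℝ Φ (f (circleMap 0 r t)) (Complex.I * g (circleMap 0 r t)))]
    · have := (periodic_circleMap 0 r) 0
      rw [zero_add] at this
      simp [this]
    · intro t _
      have h1 := ((hDd _).comp_hasDerivAt t (hcomp hf (hzt t))).clm_apply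
        ((hcomp hgd (hzt t)).const_mul Complex.I)
      refine h1.congr_deriv ?_
      have e1 : deriv f (circleMap 0 r t) * (circleMap 0 r t * Complex.I) =
          Complex.I * g (circleMap 0 r t) := by simp only [hg]; ring
      have e2 : Complex.I * (deriv g (circleMap 0 r t) * (circleMap 0 r t * Complex.I)) =
          -(circleMap 0 r t * deriv g (circleMap 0 r t)) := by
        linear_combination (deriv g (circleMap 0 r t) * circleMap 0 r t) * Complex.I_mul_I
      rw [e1, e2, map_neg, sub_eq_add_neg]
      rfl
    · refine Continuous.intervalIntegrable ?_ _ _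
      exact (((hD2c.comp (hfc.comp hzc')).clm_apply
        (continuous_const.mul (hgc.comp hzc'))).clm_apply
        (continuous_const.mul (hgc.comp hzc'))).sub
        ((hDc.comp (hfc.comp hzc')).clm_apply (hzc'.mul (hg'c.comp hzc')))
  have hk' : ∀ r : ℝ, 0 < r → 0 ≤ ∫ t in (0 : ℝ)..(2 * Real.pi), K' r t := by
    intro r hr
    have hzc' : Continuous fun t : ℝ => circleMap 0 r t := continuous_circleMap 0 r
    -- The identity `(r ∂_r)² + ∂_t² = r² Δ`: after multiplication by `r` and addition of the
    -- vanishing angular integral, the first-order terms cancel and the integrand is `|g|² ΔΦ(f) ≥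
    -- 0`.
    refine nonneg_of_mul_nonneg_right ?_ hr
    rw [← intervalIntegral.integral_const_mul]
    refine le_of_le_of_eq ?_ ((congrArg (_ + ·) (hang r)).trans (add_zero _))
    rw [← intervalIntegral.integral_add]
    · refine intervalIntegral.integral_nonneg (by positivity) fun t _ => ?_
      have e1 : r * fderiv ℝ (fderiv ℝ Φ) (f (circleMap 0 r t))
          (deriv f (circleMap 0 r t) * e t) (g (circleMap 0 r t)) =
          fderiv ℝ (fderiv ℝ Φ) (f (circleMap 0 r t)) (g (circleMap 0 r t))
            (g (circleMap 0 r t)) := by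
        have : g (circleMap 0 r t) = r • (deriv f (circleMap 0 r t) * e t) := by
          simp only [hg, circleMap, he, Complex.real_smul]; ring
        generalize deriv f (circleMap 0 r t) * e t = w at this
        rw [this]
        simp only [map_smul, smul_apply, smul_eq_mul]
      have e2 : r * fderiv ℝ Φ (f (circleMap 0 r t)) (deriv g (circleMap 0 r t) * e t) =
          fderiv ℝ Φ (f (circleMap 0 r t)) (circleMap 0 r t * deriv g (circleMap 0 r t)) := by
        have : circleMap 0 r t * deriv g (circleMap 0 r t) =
            r • (deriv g (circleMap 0 r t) * e t) := by
          simp only [circleMap, he, Complex.real_smul]; ring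
        rw [this, map_smul, smul_eq_mul]
      simp only [hK', mul_add, e1, e2]
      have := bilin_add_bilin_I (fderiv ℝ (fderiv ℝ Φ) (f (circleMap 0 r t))) (hsymm _)
        (g (circleMap 0 r t))
      have h3 := mul_nonneg (sq_nonneg ‖g (circleMap 0 r t)‖) (hlap (f (circleMap 0 r t)))
      linarith
    · refine Continuous.intervalIntegrable (continuous_const.mul ?_) _ _
      exact (((hD2c.comp (hfc.comp hzc')).clm_apply
        ((hf'c.comp hzc').mul hec)).clm_apply (hgc.comp hzc')).add
        ((hDc.comp (hfc.comp hzc')).clm_apply ((hg'c.comp hzc').mul hec))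
    · refine Continuous.intervalIntegrable ?_ _ _
      exact (((hD2c.comp (hfc.comp hzc')).clm_apply
        (continuous_const.mul (hgc.comp hzc'))).clm_apply
        (continuous_const.mul (hgc.comp hzc'))).sub
        ((hDc.comp (hfc.comp hzc')).clm_apply (hzc'.mul (hg'c.comp hzc')))
  have hkmono : MonotoneOn (fun r => ∫ t in (0 : ℝ)..(2 * Real.pi), K r t) (Set.Ici 0) := by
    refine monotoneOn_of_deriv_nonneg (convex_Ici 0)
      (fun r _ => (hk r).continuousAt.continuousWithinAt)
      (fun r _ => (hk r).differentiableAt.differentiableWithinAt) ?_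
    intro r hr
    rw [interior_Ici] at hr
    rw [(hk r).deriv]
    exact hk' r hr
  refine monotoneOn_of_deriv_nonneg (convex_Ici 0)
      (fun r _ => (hm r).continuousAt.continuousWithinAt)
      (fun r _ => (hm r).differentiableAt.differentiableWithinAt) ?_
  intro r hr
  rw [interior_Ici] at hr
  rw [(hm r).deriv]
  -- The integral of `K` is `r` times the derivative of the mean. It vanishes at `r = 0` and
  -- increases, so the derivative is nonnegative.
  have h0 := hkmono (Set.mem_Ici.2 le_rfl) (Set.mem_Ici.2 (le_of_lt hr)) (le_of_lt hr)
  simp only [hKH, zero_mul, intervalIntegral.integral_zero,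
    intervalIntegral.integral_const_mul] at h0
  exact nonneg_of_mul_nonneg_right h0 hr

/-- The second derivative on the diagonal is a one-variable second derivative along a line, so
Laplacians can be read off from explicit formulas. -/
theorem fderiv_fderiv_apply_eq {Φ : ℂ → ℝ} (hΦ : ContDiff ℝ 2 Φ) (z v : ℂ) {φ : ℝ → ℝ} {c : ℝ}
    (h1 : ∀ s : ℝ, HasDerivAt (fun s : ℝ => Φ (z + s * v)) (φ s) s)
    (h2 : HasDerivAt φ c 0) : fderiv ℝ (fderiv ℝ Φ) z v v = c := by
  have hD1 : ContDiff ℝ 1 (fderiv ℝ Φ) := hΦ.fderiv_right (m := 1) (by norm_num)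
  have hl : ∀ s : ℝ, HasDerivAt (fun s : ℝ => z + s * v) v s := by
    intro s
    simpa using ((Complex.ofRealCLM.hasDerivAt (x := s)).mul_const v).const_add z
  have e1 : φ = fun s : ℝ => fderiv ℝ Φ (z + s * v) v := by
    funext s
    exact (h1 s).unique
      ((hΦ.differentiable (by norm_num) (z + s * v)).hasFDerivAt.comp_hasDerivAt s (hl s))
  have hd : HasFDerivAt (fderiv ℝ Φ) (fderiv ℝ (fderiv ℝ Φ) z) (z + ((0 : ℝ) : ℂ) * v) := by
    rw [Complex.ofReal_zero, zero_mul, add_zero]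
    exact (hD1.differentiable (by norm_num) z).hasFDerivAt
  have h3 : HasDerivAt φ (fderiv ℝ (fderiv ℝ Φ) z v v) 0 := by
    rw [e1]
    exact (ContinuousLinearMap.apply ℝ ℝ v).hasFDerivAt.comp_hasDerivAt (0 : ℝ)
      (hd.comp_hasDerivAt (0 : ℝ) (hl 0))
  exact h3.unique h2

/-- A criterion for subharmonicity in terms of the pure second partial derivatives. -/
theorem isC2Subharmonic_of_partials {Φ : ℝ → ℝ → ℝ} {A A' B B' : ℝ → ℝ → ℝ}
    (hΦ : ContDiff ℝ 2 fun z : ℂ => Φ z.re z.im)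
    (hA : ∀ x y, HasDerivAt (fun x => Φ x y) (A x y) x)
    (hA' : ∀ x y, HasDerivAt (fun x => A x y) (A' x y) x)
    (hB : ∀ x y, HasDerivAt (fun y => Φ x y) (B x y) y)
    (hB' : ∀ x y, HasDerivAt (fun y => B x y) (B' x y) y)
    (hpos : ∀ x y, 0 ≤ A' x y + B' x y) :
    IsC2Subharmonic fun z : ℂ => Φ z.re z.im := by
  refine ⟨hΦ, fun z => ?_⟩
  have e1 := fderiv_fderiv_apply_eq hΦ z 1 (φ := fun s => A (z.re + s) z.im)
    (c := A' z.re z.im)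
    (by intro s; simpa using (hA (z.re + s) z.im).comp_const_add z.re s)
    (by simpa using (hA' (z.re + 0) z.im).comp_const_add z.re 0)
  have e2 := fderiv_fderiv_apply_eq hΦ z Complex.I (φ := fun s => B z.re (z.im + s))
    (c := B' z.re z.im)
    (by intro s; simpa using (hB z.re (z.im + s)).comp_const_add z.im s)
    (by simpa using (hB' z.re (z.im + 0)).comp_const_add z.im 0)
  rw [e1, e2]
  exact hpos _ _

/-! ### Explicit subharmonic functions built from regularized powers -/

theorem hasDerivAt_sq_add_rpow (a : ℝ) {c : ℝ} (hc : 0 < c) (x : ℝ) :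
    HasDerivAt (fun x : ℝ => (x ^ 2 + c) ^ a) (2 * a * x * (x ^ 2 + c) ^ (a - 1)) x := by
  have h := ((hasDerivAt_pow 2 x).add_const c).rpow_const (p := a) (Or.inl (by positivity))
  refine (h.congr_deriv ?_)
  push_cast
  ring

theorem hasDerivAt_sq_add_rpow' (a : ℝ) {c : ℝ} (hc : 0 < c) (x : ℝ) :
    HasDerivAt (fun x : ℝ => 2 * a * x * (x ^ 2 + c) ^ (a - 1))
      (2 * a * (x ^ 2 + c) ^ (a - 1) + 4 * a * (a - 1) * x ^ 2 * (x ^ 2 + c) ^ (a - 2)) x := by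
  have h := ((hasDerivAt_id' x).const_mul (2 * a)).mul (hasDerivAt_sq_add_rpow (a - 1) hc x)
  refine (h.congr_deriv ?_)
  rw [show a - 1 - 1 = a - 2 by ring]
  ring

theorem hasDerivAt_sq_mul_rpow (b : ℝ) {c : ℝ} (hc : 0 < c) (x : ℝ) :
    HasDerivAt (fun x : ℝ => x ^ 2 * (x ^ 2 + c) ^ b)
      (2 * x * (x ^ 2 + c) ^ b + 2 * b * x ^ 3 * (x ^ 2 + c) ^ (b - 1)) x := by
  have h := (hasDerivAt_pow 2 x).mul (hasDerivAt_sq_add_rpow b hc x)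
  refine (h.congr_deriv ?_)
  push_cast
  ring

theorem hasDerivAt_sq_mul_rpow' (b : ℝ) {c : ℝ} (hc : 0 < c) (x : ℝ) :
    HasDerivAt (fun x : ℝ => 2 * x * (x ^ 2 + c) ^ b + 2 * b * x ^ 3 * (x ^ 2 + c) ^ (b - 1))
      (2 * (x ^ 2 + c) ^ b + 10 * b * x ^ 2 * (x ^ 2 + c) ^ (b - 1) +
        4 * b * (b - 1) * x ^ 4 * (x ^ 2 + c) ^ (b - 2)) x := by
  have h := (((hasDerivAt_id' x).const_mul 2).mul (hasDerivAt_sq_add_rpow b hc x)).add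
    (((hasDerivAt_pow 3 x).const_mul (2 * b)).mul (hasDerivAt_sq_add_rpow (b - 1) hc x))
  refine (h.congr_deriv ?_)
  rw [show b - 1 - 1 = b - 2 by ring]
  push_cast
  ring

theorem contDiff_sq_add_sq_rpow {ε : ℝ} (hε : 0 < ε) (a : ℝ) :
    ContDiff ℝ 2 fun z : ℂ => (z.re ^ 2 + z.im ^ 2 + ε) ^ a :=
  (((Complex.reCLM.contDiff.pow 2).add (Complex.imCLM.contDiff.pow 2)).add
    contDiff_const).rpow_const_of_ne fun z => by
      simp only [Complex.reCLM_apply, Complex.imCLM_apply]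
      positivity

/-- The shift by `ε` makes `|z|^p` smooth at the origin; with `W = |z|² + ε` and `a = p/2` the
Laplacian is `4a W^{a-2} (a|z|² + ε)`. -/
theorem isC2Subharmonic_rpow {ε a : ℝ} (hε : 0 < ε) (ha : 0 < a) :
    IsC2Subharmonic fun z : ℂ => (z.re ^ 2 + z.im ^ 2 + ε) ^ a := by
  refine isC2Subharmonic_of_partials (Φ := fun x y => (x ^ 2 + y ^ 2 + ε) ^ a)
    (A := fun x y => 2 * a * x * (x ^ 2 + (y ^ 2 + ε)) ^ (a - 1))
    (B := fun x y => 2 * a * y * (y ^ 2 + (x ^ 2 + ε)) ^ (a - 1))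
    (contDiff_sq_add_sq_rpow hε a) ?_
    (fun x y => hasDerivAt_sq_add_rpow' a (by positivity) x) ?_
    (fun x y => hasDerivAt_sq_add_rpow' a (by positivity) y) ?_
  · intro x y
    simpa only [add_assoc] using hasDerivAt_sq_add_rpow a (c := y ^ 2 + ε) (by positivity) x
  · intro x y
    have e : ∀ s : ℝ, x ^ 2 + s ^ 2 + ε = s ^ 2 + (x ^ 2 + ε) := fun s => by ring
    simp only [e]
    exact
      hasDerivAt_sq_add_rpow a (c := x ^ 2 + ε) (by positivity) y
  · intro x y
    have hW : 0 < x ^ 2 + (y ^ 2 + ε) := by positivity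
    rw [show y ^ 2 + (x ^ 2 + ε) = x ^ 2 + (y ^ 2 + ε) by ring]
    set W := x ^ 2 + (y ^ 2 + ε) with hWd
    have e1 : W ^ (a - 1) = W ^ (a - 2) * W := by
      rw [← Real.rpow_add_one hW.ne']; ring_nf
    have hw : 0 < W ^ (a - 2) := by positivity
    rw [e1]
    have : 2 * a * (W ^ (a - 2) * W) + 4 * a * (a - 1) * x ^ 2 * W ^ (a - 2) +
        (2 * a * (W ^ (a - 2) * W) + 4 * a * (a - 1) * y ^ 2 * W ^ (a - 2)) =
        4 * a * W ^ (a - 2) * (a * (x ^ 2 + y ^ 2) + ε) := by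
      rw [hWd]; ring
    rw [this]
    positivity

/-- With `U = x² + ε`, `W = |z|² + ε` and `a = p/2 ≤ 1`, the first term has Laplacian at least
`2a(2a-1) U^{a-1}` and `W^a` has Laplacian at most `4a W^{a-1}`. The factor `(p-1)/2` makes the
coefficients agree, and `W ≥ U` with exponent `a - 1 ≤ 0` finishes. -/
theorem isC2Subharmonic_of_le_two {ε p : ℝ} (hε : 0 < ε) (hp : 1 < p) (hp2 : p ≤ 2) :
    IsC2Subharmonic fun z : ℂ => (z.re ^ 2 + ε) ^ (p / 2) -
      (p - 1) / 2 * (z.re ^ 2 + z.im ^ 2 + ε) ^ (p / 2) := by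
  obtain ⟨a, rfl⟩ : ∃ a, p = 2 * a := ⟨p / 2, by ring⟩
  rw [show 2 * a / 2 = a by ring]
  refine isC2Subharmonic_of_partials
    (Φ := fun x y => (x ^ 2 + ε) ^ a - (2 * a - 1) / 2 * (x ^ 2 + y ^ 2 + ε) ^ a)
    (A := fun x y => 2 * a * x * (x ^ 2 + ε) ^ (a - 1) -
      (2 * a - 1) / 2 * (2 * a * x * (x ^ 2 + (y ^ 2 + ε)) ^ (a - 1)))
    (B := fun x y => -((2 * a - 1) / 2 * (2 * a * y * (y ^ 2 + (x ^ 2 + ε)) ^ (a - 1))))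
    ?_ ?_
    (fun x y => (hasDerivAt_sq_add_rpow' a hε x).sub
      ((hasDerivAt_sq_add_rpow' a (by positivity) x).const_mul _)) ?_
    (fun x y => ((hasDerivAt_sq_add_rpow' a (by positivity) y).const_mul _).neg) ?_
  · refine ContDiff.sub ?_ (contDiff_const.mul (contDiff_sq_add_sq_rpow hε a))
    exact ((Complex.reCLM.contDiff.pow 2).add contDiff_const).rpow_const_of_ne fun z => by
      simp only [Complex.reCLM_apply]
      positivity
  · intro x y
    simp only [add_assoc]
    exact (hasDerivAt_sq_add_rpow a hε x).fun_sub
      ((hasDerivAt_sq_add_rpow a (c := y ^ 2 + ε) (by positivity) x).const_mul ((2 * a - 1) / 2))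
  · intro x y
    have e : ∀ s : ℝ, x ^ 2 + s ^ 2 + ε = s ^ 2 + (x ^ 2 + ε) := fun s => by ring
    simp only [e]
    exact
      ((hasDerivAt_sq_add_rpow a (c := x ^ 2 + ε) (by positivity) y).const_mul
        ((2 * a - 1) / 2)).const_sub ((x ^ 2 + ε) ^ a)
  · intro x y
    have hU : 0 < x ^ 2 + ε := by positivity
    have hW : 0 < x ^ 2 + (y ^ 2 + ε) := by positivity
    rw [show y ^ 2 + (x ^ 2 + ε) = x ^ 2 + (y ^ 2 + ε) by ring]
    have hle : (x ^ 2 + (y ^ 2 + ε)) ^ (a - 1) ≤ (x ^ 2 + ε) ^ (a - 1) :=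
      Real.rpow_le_rpow_of_nonpos hU (by nlinarith [sq_nonneg y]) (by linarith)
    set W := x ^ 2 + (y ^ 2 + ε) with hWd
    set U := x ^ 2 + ε with hUd
    have e1 : W ^ (a - 1) = W ^ (a - 2) * W := by
      rw [← Real.rpow_add_one hW.ne']; ring_nf
    have e2 : U ^ (a - 1) = U ^ (a - 2) * U := by
      rw [← Real.rpow_add_one hU.ne']; ring_nf
    have hw : 0 < W ^ (a - 2) := by positivity
    have k1 : 2 * a * (2 * a - 1) * U ^ (a - 1) ≤
        2 * a * U ^ (a - 1) + 4 * a * (a - 1) * x ^ 2 * U ^ (a - 2) := by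
      have : 0 ≤ 4 * a * (1 - a) * ε * U ^ (a - 2) := by
        have : 0 ≤ 1 - a := by linarith
        have : 0 < a := by linarith
        positivity
      have h3 : 2 * a * U ^ (a - 1) + 4 * a * (a - 1) * x ^ 2 * U ^ (a - 2) -
        2 * a * (2 * a - 1) * U ^ (a - 1) = 4 * a * (1 - a) * ε * U ^ (a - 2) := by
        rw [e2, hUd]; ring
      linarith
    have k2 : (2 * a * W ^ (a - 1) + 4 * a * (a - 1) * x ^ 2 * W ^ (a - 2)) +
        (2 * a * W ^ (a - 1) + 4 * a * (a - 1) * y ^ 2 * W ^ (a - 2)) ≤ 4 * a * W ^ (a - 1) := by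
      have : 0 ≤ 4 * a * (1 - a) * (x ^ 2 + y ^ 2) * W ^ (a - 2) := by
        have : 0 ≤ 1 - a := by linarith
        have : 0 < a := by linarith
        positivity
      linarith
    have k3 := mul_le_mul_of_nonneg_left k2 (show 0 ≤ (2 * a - 1) / 2 by linarith)
    have k4 := mul_le_mul_of_nonneg_left hle (show 0 ≤ 2 * a * (2 * a - 1) by nlinarith)
    linarith

/-- For `p > 2` the Laplacian of `|x|^p` vanishes on the imaginary axis and cannot dominate that of
`|z|^p`. The function `x² |z|^{p-2}` keeps the contribution `2|z|^{p-2}` there, and `p²/2` is the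
factor that this contribution requires. -/
theorem isC2Subharmonic_of_two_le {ε p : ℝ} (hε : 0 < ε) (hp2 : 2 ≤ p) :
    IsC2Subharmonic fun z : ℂ =>
      p ^ 2 / 2 * (z.re ^ 2 * (z.re ^ 2 + z.im ^ 2 + ε) ^ (p / 2 - 1)) -
      (z.re ^ 2 + z.im ^ 2 + ε) ^ (p / 2) := by
  obtain ⟨b, rfl⟩ : ∃ b, p = 2 * (b + 1) := ⟨p / 2 - 1, by ring⟩
  have hb : 0 ≤ b := by linarith
  rw [show 2 * (b + 1) / 2 = b + 1 by ring, show b + 1 - 1 = b by ring]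
  set m := (2 * (b + 1)) ^ 2 / 2 with hm
  refine isC2Subharmonic_of_partials
    (Φ := fun x y => m * (x ^ 2 * (x ^ 2 + y ^ 2 + ε) ^ b) - (x ^ 2 + y ^ 2 + ε) ^ (b + 1))
    (A := fun x y => m * (2 * x * (x ^ 2 + (y ^ 2 + ε)) ^ b +
        2 * b * x ^ 3 * (x ^ 2 + (y ^ 2 + ε)) ^ (b - 1)) -
      2 * (b + 1) * x * (x ^ 2 + (y ^ 2 + ε)) ^ (b + 1 - 1))
    (B := fun x y => m * (x ^ 2 * (2 * b * y * (y ^ 2 + (x ^ 2 + ε)) ^ (b - 1))) -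
      2 * (b + 1) * y * (y ^ 2 + (x ^ 2 + ε)) ^ (b + 1 - 1))
    ?_ ?_
    (fun x y => ((hasDerivAt_sq_mul_rpow' b (by positivity) x).const_mul _).sub
      (hasDerivAt_sq_add_rpow' (b + 1) (by positivity) x)) ?_
    (fun x y => (((hasDerivAt_sq_add_rpow' b (by positivity) y).const_mul _).const_mul _).sub
      (hasDerivAt_sq_add_rpow' (b + 1) (by positivity) y)) ?_
  · exact (contDiff_const.mul ((Complex.reCLM.contDiff.pow 2).mul
      (contDiff_sq_add_sq_rpow hε b))).sub (contDiff_sq_add_sq_rpow hε (b + 1))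
  · intro x y
    simp only [add_assoc]
    exact
      ((hasDerivAt_sq_mul_rpow b (c := y ^ 2 + ε) (by positivity) x).const_mul m).fun_sub
      (hasDerivAt_sq_add_rpow (b + 1) (c := y ^ 2 + ε) (by positivity) x)
  · intro x y
    have e : ∀ s : ℝ, x ^ 2 + s ^ 2 + ε = s ^ 2 + (x ^ 2 + ε) := fun s => by ring
    simp only [e]
    exact
      (((hasDerivAt_sq_add_rpow b (c := x ^ 2 + ε) (by positivity) y).const_mul
        (x ^ 2)).const_mul m).fun_sub
      (hasDerivAt_sq_add_rpow (b + 1) (c := x ^ 2 + ε) (by positivity) y)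
  · intro x y
    have hW : 0 < x ^ 2 + (y ^ 2 + ε) := by positivity
    rw [show y ^ 2 + (x ^ 2 + ε) = x ^ 2 + (y ^ 2 + ε) by ring]
    rw [show b + 1 - 1 = b by ring, show b + 1 - 2 = b - 1 by ring]
    set W := x ^ 2 + (y ^ 2 + ε) with hWd
    have e1 : W ^ (b - 1) = W ^ (b - 2) * W := by
      rw [← Real.rpow_add_one hW.ne']; ring_nf
    have e2 : W ^ b = W ^ (b - 2) * W ^ 2 := by
      rw [← Real.rpow_add_natCast hW.ne']; norm_num
    have hw : 0 < W ^ (b - 2) := by positivity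
    rw [e1, e2]
    set w := W ^ (b - 2)
    have key : m * (2 * (w * W ^ 2) + 10 * b * x ^ 2 * (w * W) + 4 * b * (b - 1) * x ^ 4 * w) -
        (2 * (b + 1) * (w * W ^ 2) + 4 * (b + 1) * b * x ^ 2 * (w * W)) +
        (m * (x ^ 2 * (2 * b * (w * W) + 4 * b * (b - 1) * y ^ 2 * w)) -
        (2 * (b + 1) * (w * W ^ 2) + 4 * (b + 1) * b * y ^ 2 * (w * W))) =
        w * (4 * b * (b + 1) * ε * W + m * (8 * b * x ^ 2 * W + 4 * b * ε * x ^ 2 +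
          4 * b ^ 2 * x ^ 2 * (x ^ 2 + y ^ 2))) := by
      rw [hm, hWd]; ring
    have hm0 : 0 ≤ m := by positivity
    refine le_of_le_of_eq ?_ (Eq.trans key.symm ?_)
    · positivity
    · ring

/-- Monotonicity of circular means passes to the limit of vanishing regularization. -/
theorem monotoneOn_integral_comp_of_limit {Ψ : ℝ → ℂ → ℝ} (hc : Continuous (Function.uncurry Ψ))
    (hs : ∀ ε, 0 < ε → IsC2Subharmonic (Ψ ε)) {f : ℂ → ℂ} (hf : Differentiable ℂ f) :
    MonotoneOn (fun r : ℝ => ∫ t in (0 : ℝ)..(2 * Real.pi), Ψ 0 (f (circleMap 0 r t)))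
      (Set.Ici 0) := by
  have hlim : ∀ r : ℝ, Filter.Tendsto
      (fun ε => ∫ t in (0 : ℝ)..(2 * Real.pi), Ψ ε (f (circleMap 0 r t)))
      (nhdsWithin 0 (Set.Ioi 0))
      (nhds (∫ t in (0 : ℝ)..(2 * Real.pi), Ψ 0 (f (circleMap 0 r t)))) := by
    intro r
    have : Continuous fun ε => ∫ t in (0 : ℝ)..(2 * Real.pi), Ψ ε (f (circleMap 0 r t)) := by
      refine intervalIntegral.continuous_parametric_intervalIntegral_of_continuous' ?_ _ _
      exact hc.comp (continuous_fst.prodMk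
        (hf.continuous.comp ((continuous_circleMap 0 r).comp continuous_snd)))
    exact this.continuousAt.tendsto.mono_left nhdsWithin_le_nhds
  intro r hr s hs' hrs
  refine le_of_tendsto_of_tendsto (hlim r) (hlim s) ?_
  filter_upwards [self_mem_nhdsWithin] with ε hε
  exact monotoneOn_integral_comp_circleMap (hs ε hε) hf hr hs' hrs

/-! ### Monotone means and M. Riesz's inequality -/

theorem sq_rpow_half {x p : ℝ} (hx : 0 ≤ x) : (x ^ 2) ^ (p / 2) = x ^ p := by
  rw [← Real.rpow_natCast, ← Real.rpow_mul hx]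
  congr 1
  push_cast
  ring

theorem norm_rpow_eq (z : ℂ) (p : ℝ) : (z.re ^ 2 + z.im ^ 2) ^ (p / 2) = ‖z‖ ^ p := by
  rw [← sq_rpow_half (norm_nonneg z), Complex.sq_norm, Complex.normSq_apply, sq, sq]

/-- The integral means of an entire function increase with the radius. -/
theorem monotoneOn_integral_norm_rpow {p : ℝ} (hp : 0 < p) {f : ℂ → ℂ}
    (hf : Differentiable ℂ f) :
    MonotoneOn (fun r : ℝ => ∫ t in (0 : ℝ)..(2 * Real.pi), ‖f (circleMap 0 r t)‖ ^ p)
      (Set.Ici 0) := by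
  have := monotoneOn_integral_comp_of_limit
    (Ψ := fun ε z => (z.re ^ 2 + z.im ^ 2 + ε) ^ (p / 2)) ?_
    (fun ε hε => isC2Subharmonic_rpow hε (by positivity)) hf
  · simpa only [add_zero, norm_rpow_eq] using this
  · refine Continuous.rpow_const (by fun_prop) fun _ => Or.inr (by positivity)

/-- Split at `|z| = p |Re z|`. Where `|Re z|` is small, the left side is at most half of `|z|^p`,
which can be absorbed; elsewhere `|z|` is controlled by `|Re z|`. -/
theorem re_sq_mul_norm_rpow_le {p : ℝ} (hp : 2 ≤ p) (z : ℂ) :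
    p ^ 2 / 2 * (z.re ^ 2 * (z.re ^ 2 + z.im ^ 2) ^ (p / 2 - 1)) ≤
      (1 / 2) * ‖z‖ ^ p + (p ^ 2 / 2) * (p ^ 2) ^ (p / 2 - 1) * |z.re| ^ p := by
  set W := z.re ^ 2 + z.im ^ 2 with hW
  have hW0 : 0 ≤ W := by positivity
  have hb : 0 ≤ p / 2 - 1 := by linarith
  rcases le_or_gt (p ^ 2 * z.re ^ 2) W with h | h
  · have h1 : W ^ (p / 2) = W * W ^ (p / 2 - 1) := by
      rcases hW0.eq_or_lt with h0 | h0
      · rw [← h0, Real.zero_rpow (by linarith), zero_mul]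
      · rw [Real.rpow_sub_one h0.ne']; field_simp
    rw [← norm_rpow_eq, ← hW, h1]
    have h2 : 0 ≤ W ^ (p / 2 - 1) := by positivity
    have h3 : 0 ≤ (p ^ 2 / 2) * (p ^ 2) ^ (p / 2 - 1) * |z.re| ^ p := by positivity
    nlinarith
  · have h1 : W ^ (p / 2 - 1) ≤ (p ^ 2) ^ (p / 2 - 1) * (z.re ^ 2) ^ (p / 2 - 1) := by
      rw [← Real.mul_rpow (by positivity) (by positivity)]
      exact Real.rpow_le_rpow hW0 h.le hb
    have h2 : z.re ^ 2 * (z.re ^ 2) ^ (p / 2 - 1) = |z.re| ^ p := by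
      rw [← sq_rpow_half (abs_nonneg _), sq_abs]
      rcases (sq_nonneg z.re).eq_or_lt with h0 | h0
      · rw [← h0, zero_mul, Real.zero_rpow (by linarith)]
      · rw [Real.rpow_sub_one h0.ne', ← mul_div_assoc, mul_div_cancel_left₀ _ h0.ne']
    have h3 : z.re ^ 2 * W ^ (p / 2 - 1) ≤ (p ^ 2) ^ (p / 2 - 1) * |z.re| ^ p := by
      rw [← h2]
      calc _ ≤ z.re ^ 2 * ((p ^ 2) ^ (p / 2 - 1) * (z.re ^ 2) ^ (p / 2 - 1)) := by gcongr
        _ = _ := by ring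
    have h4 : 0 ≤ ‖z‖ ^ p := by positivity
    have h5 := mul_le_mul_of_nonneg_left h3 (show 0 ≤ p ^ 2 / 2 by positivity)
    linarith

/-- M. Riesz: an entire function vanishing at the origin is controlled on the unit circle by its
real part, in the `L^p` sense. -/
theorem exists_integral_norm_rpow_le_integral_re {p : ℝ} (hp : 1 < p) :
    ∃ C : ℝ, 0 < C ∧ ∀ f : ℂ → ℂ, Differentiable ℂ f → f 0 = 0 →
      ∫ t in (0 : ℝ)..(2 * Real.pi), ‖f (circleMap 0 1 t)‖ ^ p ≤
        C * ∫ t in (0 : ℝ)..(2 * Real.pi), |(f (circleMap 0 1 t)).re| ^ p := by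
  have hI : ∀ f : ℂ → ℂ, Differentiable ℂ f →
      IntervalIntegrable (fun t => ‖f (circleMap 0 1 t)‖ ^ p) volume 0 (2 * Real.pi) ∧
      IntervalIntegrable (fun t => |(f (circleMap 0 1 t)).re| ^ p) volume 0 (2 * Real.pi) := by
    intro f hf
    have hfc : Continuous fun t => f (circleMap 0 1 t) :=
      hf.continuous.comp (continuous_circleMap 0 1)
    constructor
    · exact (hfc.norm.rpow_const fun _ => Or.inr (by linarith)).intervalIntegrable _ _
    · exact ((Complex.continuous_re.comp hfc).abs.rpow_const
        fun _ => Or.inr (by linarith)).intervalIntegrable _ _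
  rcases le_total p 2 with hp2 | hp2
  · refine ⟨2 / (p - 1), by have : 0 < p - 1 := by linarith
                            positivity, fun f hf hf0 => ?_⟩
    have hmono := monotoneOn_integral_comp_of_limit
      (Ψ := fun ε z => (z.re ^ 2 + ε) ^ (p / 2) -
        (p - 1) / 2 * (z.re ^ 2 + z.im ^ 2 + ε) ^ (p / 2)) ?_
      (fun ε hε => isC2Subharmonic_of_le_two hε hp hp2) hf
    -- Since `f 0 = 0`, the mean at radius `0` vanishes, so the mean at radius `1` is nonnegative.
    -- The second case uses the same comparison.
    · have h := hmono (Set.mem_Ici.2 le_rfl) (Set.mem_Ici.2 zero_le_one) zero_le_one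
      have hp0 : p / 2 ≠ 0 := by positivity
      simp only [add_zero, norm_rpow_eq, circleMap_zero_radius, Function.const_apply, hf0,
        Complex.zero_re] at h
      have e : ∀ x : ℝ, (x ^ 2) ^ (p / 2) = |x| ^ p := fun x => by
        rw [← sq_rpow_half (abs_nonneg x), sq_abs]
      simp only [e, Complex.zero_im, ne_eq, OfNat.ofNat_ne_zero, not_false_eq_true, zero_pow,
        add_zero, Real.zero_rpow hp0, mul_zero, sub_zero,
        intervalIntegral.integral_zero] at h
      rw [intervalIntegral.integral_sub (hI f hf).2 ((hI f hf).1.const_mul _),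
        intervalIntegral.integral_const_mul] at h
      rw [div_mul_eq_mul_div, le_div_iff₀ (by linarith)]
      linarith
    · refine (Continuous.rpow_const (by fun_prop) fun _ => Or.inr (by positivity)).sub
        (continuous_const.mul (Continuous.rpow_const (by fun_prop) fun _ => Or.inr (by positivity)))
  · refine ⟨p ^ 2 * (p ^ 2) ^ (p / 2 - 1), by positivity, fun f hf hf0 => ?_⟩
    have hmono := monotoneOn_integral_comp_of_limit
      (Ψ := fun ε z => p ^ 2 / 2 * (z.re ^ 2 * (z.re ^ 2 + z.im ^ 2 + ε) ^ (p / 2 - 1)) -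
        (z.re ^ 2 + z.im ^ 2 + ε) ^ (p / 2)) ?_
      (fun ε hε => isC2Subharmonic_of_two_le hε hp2) hf
    · have h := hmono (Set.mem_Ici.2 le_rfl) (Set.mem_Ici.2 zero_le_one) zero_le_one
      have hp0 : p / 2 ≠ 0 := by positivity
      simp only [add_zero, norm_rpow_eq, circleMap_zero_radius, Function.const_apply, hf0,
        Complex.zero_re, Complex.zero_im, ne_eq, OfNat.ofNat_ne_zero, not_false_eq_true, zero_pow,
        zero_mul, mul_zero, Real.zero_rpow hp0, sub_zero, intervalIntegral.integral_zero] at h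
      -- Half of `‖f‖^p` is absorbed into the subtracted term, which doubles the remaining constant.
      have hle : ∫ t in (0 : ℝ)..(2 * Real.pi),
          (p ^ 2 / 2 * ((f (circleMap 0 1 t)).re ^ 2 *
            ((f (circleMap 0 1 t)).re ^ 2 + (f (circleMap 0 1 t)).im ^ 2) ^ (p / 2 - 1)) -
            ‖f (circleMap 0 1 t)‖ ^ p) ≤
          ∫ t in (0 : ℝ)..(2 * Real.pi), ((p ^ 2 / 2) * (p ^ 2) ^ (p / 2 - 1) *
            |(f (circleMap 0 1 t)).re| ^ p - (1 / 2) * ‖f (circleMap 0 1 t)‖ ^ p) := by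
        have hfc : Continuous fun t => f (circleMap 0 1 t) :=
          hf.continuous.comp (continuous_circleMap 0 1)
        have hre := Complex.continuous_re.comp hfc
        have him := Complex.continuous_im.comp hfc
        refine intervalIntegral.integral_mono_on (by positivity) ?_
          (((hI f hf).2.const_mul _).sub ((hI f hf).1.const_mul _)) fun t _ => ?_
        · refine (Continuous.intervalIntegrable ?_ _ _).sub (hI f hf).1
          refine continuous_const.mul ((hre.pow 2).mul ?_)
          exact ((hre.pow 2).add (him.pow 2)).rpow_const fun _ => Or.inr (by linarith)
        · have := re_sq_mul_norm_rpow_le hp2 (f (circleMap 0 1 t))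
          linarith
      rw [intervalIntegral.integral_sub ((hI f hf).2.const_mul _) ((hI f hf).1.const_mul _),
        intervalIntegral.integral_const_mul, intervalIntegral.integral_const_mul] at hle
      have := h.trans hle
      linarith
    · refine (continuous_const.mul (Continuous.mul (by fun_prop)
        (Continuous.rpow_const (by fun_prop) fun _ => Or.inr (by linarith)))).sub
        (Continuous.rpow_const (by fun_prop) fun _ => Or.inr (by positivity))

/-! ### Integral means of polynomials -/

/-- The polynomial `∑_{M ≤ k < N} a_k z^k`. -/
def blockPoly (a : ℕ → ℂ) (M N : ℕ) (z : ℂ) : ℂ :=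
  ∑ k ∈ Finset.Ico M N, a k * z ^ k

/-- The integral `∫_0^{2π} |f(re^{it})|^p dt`. -/
def circleInt (p r : ℝ) (f : ℂ → ℂ) : ℝ :=
  ∫ t in (0 : ℝ)..(2 * Real.pi), ‖f (circleMap 0 r t)‖ ^ p

theorem differentiable_sum_mul_pow (s : Finset ℕ) (a : ℕ → ℂ) (e : ℕ → ℕ) :
    Differentiable ℂ fun z : ℂ => ∑ k ∈ s, a k * z ^ e k := by
  fun_prop

theorem differentiable_blockPoly (a : ℕ → ℂ) (M N : ℕ) : Differentiable ℂ (blockPoly a M N) :=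
  differentiable_sum_mul_pow _ a id

theorem intervalIntegrable_norm_rpow {p : ℝ} (hp : 0 < p) {r : ℝ} {f : ℂ → ℂ}
    (hf : Continuous fun t : ℝ => f (circleMap 0 r t)) (a b : ℝ) :
    IntervalIntegrable (fun t => ‖f (circleMap 0 r t)‖ ^ p) volume a b :=
  (hf.norm.rpow_const fun _ => Or.inr hp.le).intervalIntegrable _ _

theorem circleInt_le_of_norm_le {p : ℝ} (hp : 0 < p) {r s c : ℝ} {f g : ℂ → ℂ} (hc : 0 ≤ c)
    (hf : Continuous fun t : ℝ => f (circleMap 0 r t))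
    (hg : Continuous fun t : ℝ => g (circleMap 0 s t))
    (h : ∀ t, ‖f (circleMap 0 r t)‖ ≤ c * ‖g (circleMap 0 s t)‖) :
    circleInt p r f ≤ c ^ p * circleInt p s g := by
  unfold circleInt
  rw [← intervalIntegral.integral_const_mul]
  refine intervalIntegral.integral_mono_on (by positivity) (intervalIntegrable_norm_rpow hp hf _ _)
    ((intervalIntegrable_norm_rpow hp hg _ _).const_mul _) fun t _ => ?_
  rw [← Real.mul_rpow hc (norm_nonneg _)]
  exact Real.rpow_le_rpow (norm_nonneg _) (h t) hp.le

theorem add_rpow_le_two_rpow_mul {x y p : ℝ} (hx : 0 ≤ x) (hy : 0 ≤ y) (hp : 0 < p) :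
    (x + y) ^ p ≤ 2 ^ p * (x ^ p + y ^ p) := by
  wlog h : x ≤ y generalizing x y
  · have := this hy hx (by linarith)
    rwa [add_comm y x, add_comm (y ^ p)] at this
  calc (x + y) ^ p ≤ (2 * y) ^ p := Real.rpow_le_rpow (by positivity) (by linarith) hp.le
    _ = 2 ^ p * y ^ p := Real.mul_rpow (by norm_num) hy
    _ ≤ _ := by
      have : 0 ≤ x ^ p := by positivity
      gcongr
      linarith

theorem circleInt_le_of_norm_le_add {p : ℝ} (hp : 0 < p) {r c : ℝ} (hc : 0 ≤ c) {f g h : ℂ → ℂ}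
    (hf : Continuous fun t : ℝ => f (circleMap 0 r t))
    (hg : Continuous fun t : ℝ => g (circleMap 0 r t))
    (hh : Continuous fun t : ℝ => h (circleMap 0 r t))
    (hle : ∀ t, ‖f (circleMap 0 r t)‖ ≤ c * (‖g (circleMap 0 r t)‖ + ‖h (circleMap 0 r t)‖)) :
    circleInt p r f ≤ (2 * c) ^ p * (circleInt p r g + circleInt p r h) := by
  unfold circleInt
  have ig := intervalIntegrable_norm_rpow hp hg 0 (2 * Real.pi)
  have ih := intervalIntegrable_norm_rpow hp hh 0 (2 * Real.pi)
  rw [← intervalIntegral.integral_add ig ih, ← intervalIntegral.integral_const_mul]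
  refine intervalIntegral.integral_mono_on (by positivity) (intervalIntegrable_norm_rpow hp hf _ _)
    ((ig.add ih).const_mul _) fun t _ => ?_
  refine (Real.rpow_le_rpow (norm_nonneg _) (hle t) hp.le).trans ?_
  rw [Real.mul_rpow hc (by positivity), Real.mul_rpow (by norm_num) hc]
  have := mul_le_mul_of_nonneg_left (add_rpow_le_two_rpow_mul (norm_nonneg (g (circleMap 0 r t)))
    (norm_nonneg (h (circleMap 0 r t))) hp) (show 0 ≤ c ^ p by positivity)
  linarith

/-- Squaring wraps the circle around itself twice, and the integrand has period `2π`. -/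
theorem circleInt_comp_sq {p : ℝ} (hp : 0 < p) {f : ℂ → ℂ}
    (hf : Continuous fun t : ℝ => f (circleMap 0 1 t)) :
    circleInt p 1 (fun z => f (z ^ 2)) = circleInt p 1 f := by
  have e : ∀ t : ℝ, circleMap 0 1 t ^ 2 = circleMap 0 1 (2 * t) := by
    intro t
    simp only [circleMap, zero_add, Complex.ofReal_one, one_mul, ← Complex.exp_nat_mul]
    push_cast
    ring_nf
  have hper : Function.Periodic (fun t : ℝ => ‖f (circleMap 0 1 t)‖ ^ p) (2 * Real.pi) := by
    intro t
    simp only [periodic_circleMap 0 1 t]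
  unfold circleInt
  simp only [e]
  rw [intervalIntegral.integral_comp_mul_left (fun t => ‖f (circleMap 0 1 t)‖ ^ p) two_ne_zero]
  have h := hper.intervalIntegral_add_zsmul_eq 2 0
  simp only [zsmul_eq_mul, zero_add] at h
  rw [mul_zero]
  push_cast at h
  rw [h fun _ _ => intervalIntegrable_norm_rpow hp hf _ _, smul_eq_mul,
    inv_mul_cancel_left₀ two_ne_zero]

/-- M. Riesz: partial sums of polynomials are bounded in `L^p` of the circle, `1 < p < ∞`. -/
theorem exists_circleInt_partialSum_le {p : ℝ} (hp : 1 < p) :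
    ∃ C : ℝ, 0 < C ∧ ∀ (a : ℕ → ℂ) (N K : ℕ), N ≤ K →
      circleInt p 1 (blockPoly a 0 N) ≤ C * circleInt p 1 (blockPoly a 0 K) := by
  have hp0 : 0 < p := by linarith
  obtain ⟨C, hC, hR⟩ := exists_integral_norm_rpow_le_integral_re hp
  refine ⟨2 * C, by positivity, fun a N K hNK => ?_⟩
  -- On the unit circle, `z^{1-2N}` times the polynomial at `z²` is `A + conj G`: frequencies at
  -- least `N` go to `A`, those below `N` to `G`. Replacing `z` by `z²` makes all exponents odd, so
  -- there is no constant term and both parts vanish at `0`, as M. Riesz's inequality requires.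
  set A : ℂ → ℂ := fun z => ∑ k ∈ Finset.Ico N K, a k * z ^ (2 * k + 1 - 2 * N) with hA
  set G : ℂ → ℂ := fun z => ∑ k ∈ Finset.Ico 0 N, (starRingEnd ℂ) (a k) * z ^ (2 * N - 1 - 2 * k)
    with hG
  have hAd : Differentiable ℂ A := differentiable_sum_mul_pow _ a fun k => 2 * k + 1 - 2 * N
  have hGd : Differentiable ℂ G :=
    differentiable_sum_mul_pow _ (fun k => (starRingEnd ℂ) (a k)) fun k => 2 * N - 1 - 2 * k
  have hA0 : A 0 = 0 := by
    refine Finset.sum_eq_zero fun k hk => ?_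
    rw [Finset.mem_Ico] at hk
    rw [zero_pow (by omega), mul_zero]
  have hG0 : G 0 = 0 := by
    refine Finset.sum_eq_zero fun k hk => ?_
    rw [Finset.mem_Ico] at hk
    rw [zero_pow (by omega), mul_zero]
  have hone : ∀ t : ℝ, ‖circleMap 0 1 t‖ = 1 := fun t => by simp
  have hcc : ∀ t : ℝ, circleMap 0 1 t * (starRingEnd ℂ) (circleMap 0 1 t) = 1 := fun t => by
    rw [Complex.mul_conj, Complex.normSq_eq_norm_sq, hone]; simp
  have hlow : ∀ t : ℝ, circleMap 0 1 t * blockPoly a 0 N (circleMap 0 1 t ^ 2) =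
      circleMap 0 1 t ^ (2 * N) * (starRingEnd ℂ) (G (circleMap 0 1 t)) := by
    intro t
    simp only [blockPoly, hG, Finset.mul_sum, map_sum]
    refine Finset.sum_congr rfl fun k hk => ?_
    rw [Finset.mem_Ico] at hk
    have e : 2 * N = (2 * k + 1) + (2 * N - 1 - 2 * k) := by omega
    conv_rhs => rw [e, pow_add]
    rw [map_mul, Complex.conj_conj, map_pow]
    have h1 : circleMap 0 1 t ^ (2 * N - 1 - 2 * k) *
        (starRingEnd ℂ) (circleMap 0 1 t) ^ (2 * N - 1 - 2 * k) = 1 := by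
      rw [← mul_pow, hcc, one_pow]
    rw [← e]
    linear_combination (-(circleMap 0 1 t ^ (2 * k + 1)) * a k) * h1
  have hup : ∀ t : ℝ, circleMap 0 1 t * blockPoly a N K (circleMap 0 1 t ^ 2) =
      circleMap 0 1 t ^ (2 * N) * A (circleMap 0 1 t) := by
    intro t
    simp only [blockPoly, hA, Finset.mul_sum]
    refine Finset.sum_congr rfl fun k hk => ?_
    rw [Finset.mem_Ico] at hk
    have e : 2 * k + 1 = 2 * N + (2 * k + 1 - 2 * N) := by omega
    have h1 : circleMap 0 1 t ^ (2 * k + 1) =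
        circleMap 0 1 t ^ (2 * N) * circleMap 0 1 t ^ (2 * k + 1 - 2 * N) := by
      rw [← pow_add, ← e]
    linear_combination a k * h1
  have hsplit : ∀ z, blockPoly a 0 K z = blockPoly a 0 N z + blockPoly a N K z := fun z =>
    (Finset.sum_Ico_consecutive _ (Nat.zero_le N) hNK).symm
  have nlow : ∀ t : ℝ, ‖blockPoly a 0 N (circleMap 0 1 t ^ 2)‖ = ‖G (circleMap 0 1 t)‖ := by
    intro t
    have := congrArg norm (hlow t)
    simpa [hone] using this
  have nall : ∀ t : ℝ, ‖blockPoly a 0 K (circleMap 0 1 t ^ 2)‖ =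
      ‖A (circleMap 0 1 t) + (starRingEnd ℂ) (G (circleMap 0 1 t))‖ := by
    intro t
    have h1 : circleMap 0 1 t * blockPoly a 0 K (circleMap 0 1 t ^ 2) = circleMap 0 1 t ^ (2 * N) *
        (A (circleMap 0 1 t) + (starRingEnd ℂ) (G (circleMap 0 1 t))) := by
      rw [hsplit, mul_add, hlow, hup]; ring
    have := congrArg norm h1
    simpa [hone] using this
  have hcont : ∀ {u : ℂ → ℂ}, Differentiable ℂ u → Continuous fun t : ℝ => u (circleMap 0 1 t) :=
    fun hu => hu.continuous.comp (continuous_circleMap 0 1)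
  have hkey : ∀ h : ℂ → ℂ, Differentiable ℂ h → h 0 = 0 →
      (∀ t : ℝ, |(h (circleMap 0 1 t)).re| ≤ ‖blockPoly a 0 K (circleMap 0 1 t ^ 2)‖) →
      circleInt p 1 h ≤ C * circleInt p 1 (blockPoly a 0 K) := by
    intro h hh h0 hle
    refine (hR h hh h0).trans (mul_le_mul_of_nonneg_left ?_ hC.le)
    rw [← circleInt_comp_sq hp0 (hcont (differentiable_blockPoly a 0 K))]
    refine intervalIntegral.integral_mono_on (by positivity) ?_
      (intervalIntegrable_norm_rpow hp0 (f := fun z => blockPoly a 0 K (z ^ 2)) ?_ _ _) fun t _ => ?_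
    · exact ((Complex.continuous_re.comp (hcont hh)).abs.rpow_const
        fun _ => Or.inr hp0.le).intervalIntegrable _ _
    · exact (differentiable_blockPoly a 0 K).continuous.comp ((continuous_circleMap 0 1).pow 2)
    · exact Real.rpow_le_rpow (abs_nonneg _) (hle t) hp0.le
  -- `Re(A + G) = Re(A + conj G)`, and up to sign `Re(i(A - G)) = Im(A + conj G)`. Thus both real
  -- parts are bounded by the modulus of the full polynomial, and `G` is half the difference of `A +
  -- G` and `A - G`.
  have k1 := hkey (fun z => A z + G z) (hAd.add hGd) (by simp [hA0, hG0]) fun t => by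
    rw [nall]
    refine le_trans (le_of_eq ?_) (Complex.abs_re_le_norm _)
    simp
  have k2 := hkey (fun z => Complex.I * (A z - G z)) ((hAd.sub hGd).const_mul _)
    (by simp [hA0, hG0]) fun t => by
    rw [nall]
    refine le_trans (le_of_eq ?_) (Complex.abs_im_le_norm _)
    simp only [Complex.mul_re, Complex.I_re, Complex.I_im, Complex.sub_im, Complex.add_im,
      Complex.conj_im, zero_mul, one_mul, zero_sub, abs_neg, ← sub_eq_add_neg]
  rw [← circleInt_comp_sq hp0 (hcont (differentiable_blockPoly a 0 N))]
  have k3 : circleInt p 1 (fun z => blockPoly a 0 N (z ^ 2)) ≤ (2 * (1 / 2)) ^ p *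
      (circleInt p 1 (fun z => A z + G z) + circleInt p 1 (fun z => Complex.I * (A z - G z))) := by
    refine circleInt_le_of_norm_le_add hp0 (by norm_num) ?_ (hcont (hAd.add hGd))
      (hcont ((hAd.sub hGd).const_mul _)) fun t => ?_
    · exact (differentiable_blockPoly a 0 N).continuous.comp ((continuous_circleMap 0 1).pow 2)
    · rw [nlow, norm_mul, Complex.norm_I, one_mul]
      have h1 : G (circleMap 0 1 t) = (1 / 2 : ℝ) * ((A (circleMap 0 1 t) + G (circleMap 0 1 t)) -
          (A (circleMap 0 1 t) - G (circleMap 0 1 t))) := by push_cast; ring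
      calc ‖G (circleMap 0 1 t)‖ = (1 / 2) * ‖(A (circleMap 0 1 t) + G (circleMap 0 1 t)) -
          (A (circleMap 0 1 t) - G (circleMap 0 1 t))‖ := by
            conv_lhs => rw [h1, norm_mul, Complex.norm_real]
            norm_num
        _ ≤ _ := by gcongr; exact norm_sub_le _ _
  rw [show (2 : ℝ) * (1 / 2) = 1 by norm_num, Real.one_rpow, one_mul] at k3
  linarith

theorem blockPoly_comp_mul (a : ℕ → ℂ) (M N : ℕ) (r t : ℝ) :
    blockPoly a M N (circleMap 0 r t) =
      blockPoly (fun k => a k * (r : ℂ) ^ k) M N (circleMap 0 1 t) := by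
  refine Finset.sum_congr rfl fun k _ => ?_
  have : circleMap 0 r t = r * circleMap 0 1 t := by simp [circleMap]
  rw [this]
  ring

theorem circleInt_blockPoly (p r : ℝ) (a : ℕ → ℂ) (M N : ℕ) :
    circleInt p r (blockPoly a M N) =
      circleInt p 1 (blockPoly (fun k => a k * (r : ℂ) ^ k) M N) := by
  simp only [circleInt, blockPoly_comp_mul a M N r]

theorem continuous_blockPoly_circleMap (a : ℕ → ℂ) (M N : ℕ) (r : ℝ) :
    Continuous fun t : ℝ => blockPoly a M N (circleMap 0 r t) :=
  (differentiable_blockPoly a M N).continuous.comp (continuous_circleMap 0 r)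

/-- A block is a difference of two partial sums. Rescaling the coefficients by `r^k` moves the
estimate from the unit circle to radius `r`, uniformly in `r`. The constant is written as `C ^ p` so
that `C` itself bounds the means. -/
theorem exists_circleInt_blockPoly_le {p : ℝ} (hp : 1 < p) :
    ∃ C : ℝ, 0 < C ∧ ∀ (a : ℕ → ℂ) (r : ℝ) (M N K : ℕ), M ≤ N → N ≤ K →
      circleInt p r (blockPoly a M N) ≤ C ^ p * circleInt p r (blockPoly a 0 K) := by
  have hp0 : 0 < p := by linarith
  obtain ⟨C, hC, hR⟩ := exists_circleInt_partialSum_le hp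
  refine ⟨(2 ^ p * (2 * C)) ^ (1 / p), by positivity, fun a r M N K hMN hNK => ?_⟩
  rw [circleInt_blockPoly, circleInt_blockPoly p r a 0 K, ← Real.rpow_mul (by positivity),
    one_div_mul_cancel hp0.ne', Real.rpow_one]
  set b := fun k => a k * (r : ℂ) ^ k
  have h1 := circleInt_le_of_norm_le_add hp0 zero_le_one (continuous_blockPoly_circleMap b M N 1)
    (continuous_blockPoly_circleMap b 0 N 1) (continuous_blockPoly_circleMap b 0 M 1) fun t => by
      have : blockPoly b M N (circleMap 0 1 t) =
          blockPoly b 0 N (circleMap 0 1 t) - blockPoly b 0 M (circleMap 0 1 t) :=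
        eq_sub_of_add_eq' (Finset.sum_Ico_consecutive _ (Nat.zero_le M) hMN)
      rw [one_mul, this]
      exact norm_sub_le _ _
  rw [mul_one] at h1
  refine h1.trans ?_
  rw [mul_assoc]
  refine mul_le_mul_of_nonneg_left ?_ (by positivity)
  linarith [hR b N K hNK, hR b M K (hMN.trans hNK)]

theorem circleInt_blockPoly_mono {p : ℝ} (hp : 0 < p) (a : ℕ → ℂ) (M N : ℕ) {r s : ℝ}
    (hr : 0 ≤ r) (hrs : r ≤ s) :
    circleInt p r (blockPoly a M N) ≤ circleInt p s (blockPoly a M N) :=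
  monotoneOn_integral_norm_rpow hp (differentiable_blockPoly a M N) hr (hr.trans hrs) hrs

/-- The quotient by `z^M` is still a polynomial, so its means increase with the radius. -/
theorem circleInt_blockPoly_le_pow_mul {p : ℝ} (hp : 0 < p) (a : ℕ → ℂ) (M N : ℕ) {r : ℝ}
    (hr : 0 ≤ r) (hr1 : r ≤ 1) :
    circleInt p r (blockPoly a M N) ≤ (r ^ M) ^ p * circleInt p 1 (blockPoly a M N) := by
  set h : ℂ → ℂ := fun z => ∑ k ∈ Finset.Ico M N, a k * z ^ (k - M) with hh
  have hd : Differentiable ℂ h := differentiable_sum_mul_pow _ a fun k => k - M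
  have hc : ∀ s : ℝ, Continuous fun t : ℝ => h (circleMap 0 s t) := fun s =>
    hd.continuous.comp (continuous_circleMap 0 s)
  have e : ∀ z, blockPoly a M N z = z ^ M * h z := by
    intro z
    simp only [blockPoly, hh, Finset.mul_sum]
    refine Finset.sum_congr rfl fun k hk => ?_
    rw [Finset.mem_Ico] at hk
    rw [mul_left_comm, ← pow_add, Nat.add_sub_cancel' hk.1]
  calc circleInt p r (blockPoly a M N) ≤ (r ^ M) ^ p * circleInt p r h := by
        refine circleInt_le_of_norm_le hp (by positivity)
          (continuous_blockPoly_circleMap a M N r) (hc r) fun t => ?_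
        rw [e, norm_mul, norm_pow, norm_circleMap_zero, abs_of_nonneg hr]
    _ ≤ (r ^ M) ^ p * circleInt p 1 h := by
        gcongr
        exact monotoneOn_integral_norm_rpow hp hd hr (Set.mem_Ici.2 zero_le_one) hr1
    _ ≤ (r ^ M) ^ p * (1 ^ p * circleInt p 1 (blockPoly a M N)) := by
        gcongr
        refine circleInt_le_of_norm_le hp zero_le_one (hc 1)
          (continuous_blockPoly_circleMap a M N 1) fun t => ?_
        rw [e, norm_mul, norm_pow, norm_circleMap_zero]
        simp
    _ = _ := by rw [Real.one_rpow, one_mul]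

theorem circleInt_blockPoly_one_le {p : ℝ} (hp : 0 < p) (a : ℕ → ℂ) (M N : ℕ) {r : ℝ}
    (hr : 0 < r) (hr1 : r ≤ 1) :
    circleInt p 1 (blockPoly a M N) ≤ ((r ^ (N - 1))⁻¹) ^ p * circleInt p r (blockPoly a M N) := by
  -- The reversed polynomial with conjugate coefficients: on `|z| = s` the block has modulus
  -- `s^{N-1} |h|`, with `h` taken at radius `1/s`. Monotonicity for `h` between radii `1` and `1/r`
  -- gives the reverse estimate.
  set h : ℂ → ℂ := fun z => ∑ k ∈ Finset.Ico M N, (starRingEnd ℂ) (a k) * z ^ (N - 1 - k) with hh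
  have hd : Differentiable ℂ h := differentiable_sum_mul_pow _ _ fun k => N - 1 - k
  have hc : ∀ s : ℝ, Continuous fun t : ℝ => h (circleMap 0 s t) := fun s =>
    hd.continuous.comp (continuous_circleMap 0 s)
  have e : ∀ s : ℝ, 0 < s → ∀ t : ℝ, ‖blockPoly a M N (circleMap 0 s t)‖ =
      s ^ (N - 1) * ‖h (circleMap 0 s⁻¹ t)‖ := by
    intro s hs t
    have hv : (starRingEnd ℂ) (circleMap 0 s t) * circleMap 0 s⁻¹ t = 1 := by
      have : circleMap 0 s⁻¹ t = ((s⁻¹ ^ 2 : ℝ) : ℂ) * circleMap 0 s t := by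
        simp only [circleMap, zero_add]
        push_cast
        have : (s : ℂ) ≠ 0 := by exact_mod_cast hs.ne'
        field_simp
      rw [this, mul_left_comm, mul_comm ((starRingEnd ℂ) _), Complex.mul_conj,
        Complex.normSq_eq_norm_sq, norm_circleMap_zero, sq_abs, ← Complex.ofReal_mul, inv_pow,
        inv_mul_cancel₀ (by positivity), Complex.ofReal_one]
    have h1 : (starRingEnd ℂ) (blockPoly a M N (circleMap 0 s t)) =
        (starRingEnd ℂ) (circleMap 0 s t) ^ (N - 1) * h (circleMap 0 s⁻¹ t) := by
      simp only [blockPoly, hh, Finset.mul_sum, map_sum, map_mul, map_pow]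
      refine Finset.sum_congr rfl fun k hk => ?_
      rw [Finset.mem_Ico] at hk
      have e1 : N - 1 = k + (N - 1 - k) := by omega
      conv_rhs => rw [e1, pow_add]
      rw [← e1]
      have h2 : (starRingEnd ℂ) (circleMap 0 s t) ^ (N - 1 - k) *
          circleMap 0 s⁻¹ t ^ (N - 1 - k) = 1 := by rw [← mul_pow, hv, one_pow]
      linear_combination (-(starRingEnd ℂ) (circleMap 0 s t) ^ k * (starRingEnd ℂ) (a k)) * h2
    have h3 := congrArg norm h1
    rwa [Complex.norm_conj, norm_mul, norm_pow, Complex.norm_conj, norm_circleMap_zero,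
      abs_of_pos hs] at h3
  calc circleInt p 1 (blockPoly a M N) ≤ 1 ^ p * circleInt p 1 h := by
        refine circleInt_le_of_norm_le hp zero_le_one
          (continuous_blockPoly_circleMap a M N 1) (hc 1) fun t => ?_
        rw [e 1 one_pos, inv_one, one_pow]
    _ ≤ 1 ^ p * circleInt p r⁻¹ h := by
        gcongr
        exact monotoneOn_integral_norm_rpow hp hd (Set.mem_Ici.2 zero_le_one)
          (Set.mem_Ici.2 (by positivity)) ((one_le_inv₀ hr).2 hr1)
    _ ≤ 1 ^ p * (((r ^ (N - 1))⁻¹) ^ p * circleInt p r (blockPoly a M N)) := by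
        gcongr
        refine circleInt_le_of_norm_le hp (by positivity) (hc r⁻¹)
          (continuous_blockPoly_circleMap a M N r) fun t => ?_
        rw [e r hr, inv_mul_cancel_left₀ (by positivity)]
    _ = _ := by rw [Real.one_rpow, one_mul]

/-! ### Integral means of analytic functions -/

theorem integralMean_eq {p : ℝ} (hp : 0 < p) {r : ℝ} {f : ℂ → ℂ}
    (hf : Continuous fun t : ℝ => f (circleMap 0 r t)) :
    integralMean p r f = ENNReal.ofReal ((2 * Real.pi)⁻¹ * circleInt p r f) ^ (1 / p) := by
  have hpi : (0 : ℝ) ≤ 2 * Real.pi := by positivity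
  unfold integralMean circleInt
  rw [ENNReal.ofReal_mul (by positivity), intervalIntegral.integral_of_le hpi,
    ofReal_integral_eq_lintegral_ofReal]
  · congr 3
    funext t
    rw [← ofReal_norm, ENNReal.ofReal_rpow_of_nonneg (norm_nonneg _) hp.le]
  · exact (intervalIntegrable_iff_integrableOn_Ioc_of_le hpi).1
      (intervalIntegrable_norm_rpow hp hf _ _)
  · exact Filter.Eventually.of_forall fun t => by simp only [Pi.zero_apply]; positivity

theorem integralMean_le_of_circleInt_le {p : ℝ} (hp : 0 < p) {r s c : ℝ} {f g : ℂ → ℂ}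
    (hc : 0 ≤ c) (hf : Continuous fun t : ℝ => f (circleMap 0 r t))
    (hg : Continuous fun t : ℝ => g (circleMap 0 s t))
    (h : circleInt p r f ≤ c ^ p * circleInt p s g) :
    integralMean p r f ≤ ENNReal.ofReal c * integralMean p s g := by
  rw [integralMean_eq hp hf, integralMean_eq hp hg]
  calc ENNReal.ofReal ((2 * Real.pi)⁻¹ * circleInt p r f) ^ (1 / p)
      ≤ ENNReal.ofReal (c ^ p * ((2 * Real.pi)⁻¹ * circleInt p s g)) ^ (1 / p) := by
        refine ENNReal.rpow_le_rpow (ENNReal.ofReal_le_ofReal ?_) (by positivity)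
        rw [mul_left_comm]
        exact mul_le_mul_of_nonneg_left h (by positivity)
    _ = _ := by
        rw [ENNReal.ofReal_mul (by positivity), ENNReal.mul_rpow_of_nonneg _ _ (by positivity),
          ← ENNReal.ofReal_rpow_of_nonneg hc hp.le, ← ENNReal.rpow_mul, mul_one_div_cancel hp.ne',
          ENNReal.rpow_one]

theorem integralMean_add_le {p : ℝ} (hp : 1 ≤ p) {r : ℝ} {f g : ℂ → ℂ}
    (hf : Continuous fun t : ℝ => f (circleMap 0 r t))
    (hg : Continuous fun t : ℝ => g (circleMap 0 r t)) :
    integralMean p r (fun z => f z + g z) ≤ integralMean p r f + integralMean p r g := by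
  have hp0 : 0 ≤ 1 / p := by positivity
  unfold integralMean
  simp only [ENNReal.mul_rpow_of_nonneg _ _ hp0]
  rw [← mul_add]
  refine mul_le_mul_right (le_trans ?_ (ENNReal.lintegral_Lp_add_le
    (f := fun t => ‖f (circleMap 0 r t)‖ₑ) (g := fun t => ‖g (circleMap 0 r t)‖ₑ)
    hf.enorm.aemeasurable hg.enorm.aemeasurable hp)) _
  refine ENNReal.rpow_le_rpow (lintegral_mono fun t => ?_) hp0
  exact ENNReal.rpow_le_rpow (enorm_add_le _ _) (by linarith)

theorem IsAnalyticDisc.continuous_circleMap {f : ℂ → ℂ} (hf : IsAnalyticDisc f) {r : ℝ}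
    (hr : 0 ≤ r) (hr1 : r < 1) : Continuous fun t : ℝ => f (circleMap 0 r t) :=
  hf.continuousOn.comp_continuous (_root_.continuous_circleMap 0 r) fun t => by
    rw [mem_ball_zero_iff, norm_circleMap_zero, abs_of_nonneg hr]
    exact hr1

theorem IsAnalyticDisc.hasSum_taylorCoeff {f : ℂ → ℂ} (hf : IsAnalyticDisc f) {z : ℂ}
    (hz : ‖z‖ < 1) : HasSum (fun k => taylorCoeff f k * z ^ k) (f z) := by
  have := Complex.hasSum_taylorSeries_on_ball hf (mem_ball_zero_iff.2 hz)
  refine this.congr_fun fun k => ?_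
  simp only [taylorCoeff, sub_zero, smul_eq_mul, div_eq_mul_inv]
  ring

/-- The Taylor series converges absolutely on each circle of radius `r < 1`, with a bound
independent of the angle. This carries the polynomial inequalities to analytic functions. -/
theorem tendsto_circleInt_partialSum {p : ℝ} (hp : 0 < p) {f : ℂ → ℂ} (hf : IsAnalyticDisc f)
    {r : ℝ} (hr : 0 ≤ r) (hr1 : r < 1) :
    Filter.Tendsto (fun K => circleInt p r (blockPoly (taylorCoeff f) 0 K)) Filter.atTop
      (nhds (circleInt p r f)) := by
  have hn : ∀ t : ℝ, ‖circleMap 0 r t‖ = r := fun t => by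
    rw [norm_circleMap_zero, abs_of_nonneg hr]
  have hsum : Summable fun k => ‖taylorCoeff f k‖ * r ^ k := by
    have := (hf.hasSum_taylorCoeff (z := r) (by
      rwa [Complex.norm_real, Real.norm_of_nonneg hr])).summable.norm
    simpa [abs_of_nonneg hr] using this
  refine intervalIntegral.tendsto_integral_filter_of_dominated_convergence
    (fun _ => (∑' k, ‖taylorCoeff f k‖ * r ^ k) ^ p) ?_ ?_ (by simp) ?_
  · exact Filter.Eventually.of_forall fun K =>
      ((continuous_blockPoly_circleMap _ 0 K r).norm.rpow_const
        fun _ => Or.inr hp.le).aestronglyMeasurable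
  · refine Filter.Eventually.of_forall fun K => Filter.Eventually.of_forall fun t _ => ?_
    rw [Real.norm_of_nonneg (by positivity)]
    refine Real.rpow_le_rpow (norm_nonneg _) ((norm_sum_le _ _).trans ?_) hp.le
    simp only [norm_mul, norm_pow, hn]
    exact hsum.sum_le_tsum _ fun k _ => by positivity
  · refine Filter.Eventually.of_forall fun t _ => ?_
    have h := (hf.hasSum_taylorCoeff (z := circleMap 0 r t) (by rwa [hn])).tendsto_sum_nat
    simp only [blockPoly, Nat.Ico_zero_eq_range]
    exact h.norm.rpow_const (Or.inr hp.le)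

theorem integralMean_mono {p : ℝ} (hp : 0 < p) {f : ℂ → ℂ} (hf : IsAnalyticDisc f)
    {r s : ℝ} (hr : 0 ≤ r) (hrs : r ≤ s) (hs : s < 1) :
    integralMean p r f ≤ integralMean p s f := by
  have h : circleInt p r f ≤ circleInt p s f :=
    le_of_tendsto_of_tendsto' (tendsto_circleInt_partialSum hp hf hr (hrs.trans_lt hs))
      (tendsto_circleInt_partialSum hp hf (hr.trans hrs) hs)
      fun K => circleInt_blockPoly_mono hp _ 0 K hr hrs
  have := integralMean_le_of_circleInt_le hp zero_le_one
    (hf.continuous_circleMap hr (hrs.trans_lt hs)) (hf.continuous_circleMap (hr.trans hrs) hs)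
    (by rwa [Real.one_rpow, one_mul])
  rwa [ENNReal.ofReal_one, one_mul] at this

/-- The blocks of the Taylor series are bounded by the function, uniformly in the block. -/
theorem exists_integralMean_blockPoly_le {p : ℝ} (hp : 1 < p) :
    ∃ C : ℝ, 0 < C ∧ ∀ (f : ℂ → ℂ), IsAnalyticDisc f → ∀ (r : ℝ), 0 ≤ r → r < 1 →
      ∀ M N : ℕ, M ≤ N → integralMean p r (blockPoly (taylorCoeff f) M N) ≤
        ENNReal.ofReal C * integralMean p r f := by
  have hp0 : 0 < p := by linarith
  obtain ⟨C, hC, hR⟩ := exists_circleInt_blockPoly_le hp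
  refine ⟨C, hC, fun f hf r hr hr1 M N hMN => ?_⟩
  refine integralMean_le_of_circleInt_le hp0 hC.le (continuous_blockPoly_circleMap _ M N r)
    (hf.continuous_circleMap hr hr1) ?_
  refine ge_of_tendsto ((tendsto_circleInt_partialSum hp0 hf hr hr1).const_mul _) ?_
  filter_upwards [Filter.eventually_ge_atTop N] with K hK
  exact hR _ r M N K hMN hK

/-- The means increase and are continuous up to `r = 1`, so the supremum over `r < 1` is the mean on
the unit circle. -/
theorem hardyNorm_blockPoly {p : ℝ} (hp : 0 < p) (a : ℕ → ℂ) (M N : ℕ) :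
    hardyNorm p (blockPoly a M N) = integralMean p 1 (blockPoly a M N) := by
  have hc := continuous_blockPoly_circleMap a M N
  refine le_antisymm (iSup₂_le fun r hr => ?_) ?_
  · have := integralMean_le_of_circleInt_le hp zero_le_one (hc r) (hc 1)
      (by rw [Real.one_rpow, one_mul]
          exact circleInt_blockPoly_mono hp a M N hr.1.le hr.2.le)
    rwa [ENNReal.ofReal_one, one_mul] at this
  · have hcont : Continuous fun r : ℝ => circleInt p r (blockPoly a M N) := by
      refine intervalIntegral.continuous_parametric_intervalIntegral_of_continuous' ?_ _ _
      refine Continuous.rpow_const ?_ fun _ => Or.inr hp.le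
      refine ((differentiable_blockPoly a M N).continuous.comp ?_).norm
      unfold circleMap
      fun_prop
    have hlim : Filter.Tendsto (fun r : ℝ => integralMean p r (blockPoly a M N))
        (nhdsWithin 1 (Set.Iio 1)) (nhds (integralMean p 1 (blockPoly a M N))) := by
      simp only [integralMean_eq hp (hc _)]
      exact ((ENNReal.continuous_rpow_const.comp (ENNReal.continuous_ofReal.comp
        (continuous_const.mul hcont))).tendsto 1).mono_left nhdsWithin_le_nhds
    refine le_of_tendsto hlim ?_
    filter_upwards [Ioo_mem_nhdsLT (zero_lt_one' ℝ)] with r hr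
    exact le_iSup₂_of_le r hr le_rfl

theorem integralMean_blockPoly_le {p : ℝ} (hp : 0 < p) (a : ℕ → ℂ) (M N : ℕ) {r : ℝ}
    (hr : 0 ≤ r) (hr1 : r ≤ 1) :
    integralMean p r (blockPoly a M N) ≤
      ENNReal.ofReal (r ^ M) * hardyNorm p (blockPoly a M N) := by
  rw [hardyNorm_blockPoly hp]
  exact integralMean_le_of_circleInt_le hp (by positivity) (continuous_blockPoly_circleMap a M N r)
    (continuous_blockPoly_circleMap a M N 1) (circleInt_blockPoly_le_pow_mul hp a M N hr hr1)

theorem hardyNorm_blockPoly_le {p : ℝ} (hp : 0 < p) (a : ℕ → ℂ) (M N : ℕ) {r : ℝ}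
    (hr : 0 < r) (hr1 : r ≤ 1) :
    hardyNorm p (blockPoly a M N) ≤
      ENNReal.ofReal ((r ^ (N - 1))⁻¹) * integralMean p r (blockPoly a M N) := by
  rw [hardyNorm_blockPoly hp]
  exact integralMean_le_of_circleInt_le hp (by positivity) (continuous_blockPoly_circleMap a M N 1)
    (continuous_blockPoly_circleMap a M N r) (circleInt_blockPoly_one_le hp a M N hr hr1)

theorem integralMean_blockPoly_zero_le_sum {p : ℝ} (hp : 1 ≤ p) (a : ℕ → ℂ) {m : ℕ → ℕ}
    (hm : Monotone m) (hm0 : m 0 = 0) (r : ℝ) (n : ℕ) :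
    integralMean p r (blockPoly a 0 (m n)) ≤
      ∑ k ∈ Finset.range n, integralMean p r (blockPoly a (m k) (m (k + 1))) := by
  have hp0 : 0 < p := by linarith
  induction n with
  | zero =>
    have : blockPoly a 0 (m 0) = fun _ => 0 := by
      funext z
      simp [blockPoly, hm0]
    rw [this]
    simp [integralMean, hp0]
  | succ n ih =>
    have : blockPoly a 0 (m (n + 1)) =
        fun z => blockPoly a 0 (m n) z + blockPoly a (m n) (m (n + 1)) z := by
      funext z
      exact (Finset.sum_Ico_consecutive _ (Nat.zero_le _) (hm (Nat.le_succ n))).symm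
    rw [this, Finset.sum_range_succ]
    exact (integralMean_add_le hp (continuous_blockPoly_circleMap _ _ _ _)
      (continuous_blockPoly_circleMap _ _ _ _)).trans (add_le_add ih le_rfl)

theorem integralMean_le_tsum {p : ℝ} (hp : 1 ≤ p) {f : ℂ → ℂ} (hf : IsAnalyticDisc f)
    {m : ℕ → ℕ} (hm : Monotone m) (hm0 : m 0 = 0) (hmt : Filter.Tendsto m Filter.atTop Filter.atTop)
    {r : ℝ} (hr : 0 ≤ r) (hr1 : r < 1) :
    integralMean p r f ≤
      ∑' k, integralMean p r (blockPoly (taylorCoeff f) (m k) (m (k + 1))) := by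
  have hp0 : 0 < p := by linarith
  have hlim : Filter.Tendsto (fun n => integralMean p r (blockPoly (taylorCoeff f) 0 (m n)))
      Filter.atTop (nhds (integralMean p r f)) := by
    simp only [integralMean_eq hp0 (continuous_blockPoly_circleMap _ _ _ _),
      integralMean_eq hp0 (hf.continuous_circleMap hr hr1)]
    refine ((ENNReal.continuous_rpow_const.comp ENNReal.continuous_ofReal).tendsto _).comp ?_
    exact ((tendsto_circleInt_partialSum hp0 hf hr hr1).comp hmt).const_mul _
  refine le_of_tendsto' hlim fun n => ?_
  exact (integralMean_blockPoly_zero_le_sum hp _ hm hm0 r n).trans (ENNReal.sum_le_tsum _)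

/-! ### A discrete convolution inequality -/

/-- The terms with `n ≥ k` and those with `n < k` are each dominated by one geometric series. -/
theorem tsum_pow_dist_le (d : ℝ≥0∞) (k : ℕ) : ∑' n : ℕ, d ^ Nat.dist n k ≤ 2 * (1 - d)⁻¹ := by
  rw [← (ENNReal.summable (f := fun n => d ^ Nat.dist (n + k) k)).sum_add_tsum_nat_add'
    (f := fun n => d ^ Nat.dist n k), two_mul, ← ENNReal.tsum_geometric]
  refine add_le_add ?_ (le_of_eq ?_)
  · rw [← Finset.sum_range_reflect]
    refine le_trans (Finset.sum_le_sum (g := fun j => d ^ (j + 1)) fun j hj => le_of_eq ?_) ?_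
    · rw [Finset.mem_range] at hj
      rw [Nat.dist_eq_sub_of_le (by omega)]
      congr 1
      omega
    · refine (ENNReal.sum_le_tsum _).trans ?_
      rw [tsum_eq_zero_add' ENNReal.summable (f := fun j => d ^ j)]
      exact le_add_self
  · congr 1
    funext n
    rw [Nat.dist_comm, Nat.dist_eq_sub_of_le (by omega), Nat.add_sub_cancel]

theorem tsum_rpow_le_of_le_one {q : ℝ} (hq : 0 < q) (hq1 : q ≤ 1) (u : ℕ → ℝ≥0∞) :
    (∑' k, u k) ^ q ≤ ∑' k, u k ^ q := by
  have hfin : ∀ n, (∑ k ∈ Finset.range n, u k) ^ q ≤ ∑ k ∈ Finset.range n, u k ^ q := by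
    intro n
    induction n with
    | zero => simp [hq]
    | succ n ih =>
      rw [Finset.sum_range_succ, Finset.sum_range_succ]
      exact (ENNReal.rpow_add_le_add_rpow _ _ hq.le hq1).trans (add_le_add ih le_rfl)
  have hlim := (ENNReal.continuous_rpow_const (y := q)).continuousAt.tendsto.comp
    (ENNReal.tendsto_nat_tsum u)
  exact le_of_tendsto' hlim fun n => (hfin n).trans (ENNReal.sum_le_tsum _)

/-- Hölder's inequality with respect to the measure with weights `w`. -/
theorem tsum_mul_rpow_le_of_one_le {q : ℝ} (hq1 : 1 ≤ q) (w u : ℕ → ℝ≥0∞) :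
    (∑' k, w k * u k) ^ q ≤ (∑' k, w k) ^ (q - 1) * ∑' k, w k * u k ^ q := by
  have hq : 0 < q := by linarith
  have hi : 0 ≤ 1 - q⁻¹ := sub_nonneg.2 (inv_le_one_of_one_le₀ hq1)
  have h : ∑' k, w k * u k ≤ (∑' k, w k) ^ (1 - q⁻¹) * (∑' k, w k * u k ^ q) ^ q⁻¹ := by
    rw [ENNReal.tsum_eq_iSup_sum]
    refine iSup_le fun s => (ENNReal.inner_le_weight_mul_Lp_of_nonneg s hq1 w u).trans ?_
    exact mul_le_mul' (ENNReal.rpow_le_rpow (ENNReal.sum_le_tsum s) hi)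
      (ENNReal.rpow_le_rpow (ENNReal.sum_le_tsum s) (by positivity))
  refine (ENNReal.rpow_le_rpow h hq.le).trans (le_of_eq ?_)
  rw [ENNReal.mul_rpow_of_nonneg _ _ hq.le, ← ENNReal.rpow_mul, ← ENNReal.rpow_mul,
    inv_mul_cancel₀ hq.ne', ENNReal.rpow_one, sub_mul, inv_mul_cancel₀ hq.ne', one_mul]

/-- Convolution with a two-sided geometric sequence is bounded on `ℓ^q`, `0 < q < ∞`. -/
theorem exists_tsum_tsum_pow_dist_rpow_le {q : ℝ} (hq : 0 < q) {d : ℝ≥0∞} (hd : d < 1) :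
    ∃ C : ℝ≥0∞, C ≠ ∞ ∧ ∀ x : ℕ → ℝ≥0∞,
      ∑' n, (∑' k, d ^ Nat.dist n k * x k) ^ q ≤ C * ∑' k, x k ^ q := by
  have hfin : ∀ e : ℝ≥0∞, e < 1 → 2 * (1 - e)⁻¹ ≠ ∞ := fun e he =>
    ENNReal.mul_ne_top (by simp) (ENNReal.inv_ne_top.2 (tsub_pos_of_lt he).ne')
  have hswap : ∀ (e : ℝ≥0∞) (y : ℕ → ℝ≥0∞),
      ∑' n, ∑' k, e ^ Nat.dist n k * y k ≤ 2 * (1 - e)⁻¹ * ∑' k, y k := by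
    intro e y
    rw [ENNReal.tsum_comm, ← ENNReal.tsum_mul_left]
    refine ENNReal.tsum_le_tsum fun k => ?_
    rw [ENNReal.tsum_mul_right]
    exact mul_le_mul_left (tsum_pow_dist_le e k) _
  -- For `q ≤ 1`, subadditivity of `x^q` reduces to the kernel `d^q` acting on `ℓ^1`; for `q ≥ 1`,
  -- Hölder against the kernel does the same with `d`.
  rcases le_total q 1 with h1 | h1
  · refine ⟨2 * (1 - d ^ q)⁻¹, hfin _ (ENNReal.rpow_lt_one hd hq), fun x => ?_⟩
    refine le_trans (ENNReal.tsum_le_tsum fun n => ?_) (hswap (d ^ q) fun k => x k ^ q)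
    refine (tsum_rpow_le_of_le_one hq h1 _).trans (ENNReal.tsum_le_tsum fun k => le_of_eq ?_)
    rw [ENNReal.mul_rpow_of_nonneg _ _ hq.le, ← ENNReal.rpow_natCast, ← ENNReal.rpow_natCast,
      ← ENNReal.rpow_mul, ← ENNReal.rpow_mul, mul_comm q]
  · refine ⟨(2 * (1 - d)⁻¹) ^ (q - 1) * (2 * (1 - d)⁻¹),
      ENNReal.mul_ne_top (ENNReal.rpow_ne_top_of_nonneg (by linarith) (hfin d hd)) (hfin d hd),
      fun x => ?_⟩
    rw [mul_assoc]
    refine le_trans (ENNReal.tsum_le_tsum fun n => ?_)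
      (le_trans (le_of_eq ENNReal.tsum_mul_left) (mul_le_mul_right (hswap d fun k => x k ^ q) _))
    refine (tsum_mul_rpow_le_of_one_le h1 _ _).trans (mul_le_mul_left ?_ _)
    refine ENNReal.rpow_le_rpow ?_ (by linarith)
    simp only [Nat.dist_comm n]
    exact tsum_pow_dist_le d n

/-! ### Tail integrals of doubling weights -/

namespace IsDoublingWeight

variable {ω : ℂ → ℝ}

theorem nonneg_coe (hω : IsDoublingWeight ω) {s : ℝ} (hs : 0 ≤ s) (hs1 : s < 1) :
    0 ≤ ω (s : ℂ) :=
  hω.nonneg _ (by rwa [mem_ball_zero_iff, Complex.norm_real, Real.norm_of_nonneg hs])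

theorem intervalIntegrable (hω : IsDoublingWeight ω) {a b : ℝ} (ha : a ∈ Set.Icc (0 : ℝ) 1)
    (hb : b ∈ Set.Icc (0 : ℝ) 1) : IntervalIntegrable (fun s : ℝ => ω (s : ℂ)) volume a b :=
  hω.tail_finite.mono_set (by
    rw [Set.uIcc_of_le zero_le_one]
    exact Set.uIcc_subset_Icc ha hb)

theorem tail_sub_tail (hω : IsDoublingWeight ω) {a b : ℝ} (ha : a ∈ Set.Icc (0 : ℝ) 1)
    (hb : b ∈ Set.Icc (0 : ℝ) 1) : tail ω a - tail ω b = ∫ s in a..b, ω (s : ℂ) :=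
  sub_eq_of_eq_add (intervalIntegral.integral_add_adjacent_intervals (hω.intervalIntegrable ha hb)
    (hω.intervalIntegrable hb (Set.right_mem_Icc.2 zero_le_one))).symm

theorem lintegral_Ico (hω : IsDoublingWeight ω) {a b : ℝ} (ha : 0 ≤ a) (hab : a ≤ b)
    (hb : b < 1) : ∫⁻ s in Set.Ico a b, ENNReal.ofReal (ω (s : ℂ)) =
      ENNReal.ofReal (tail ω a - tail ω b) := by
  have ha' : a ∈ Set.Icc (0 : ℝ) 1 := ⟨ha, hab.trans hb.le⟩
  have hb' : b ∈ Set.Icc (0 : ℝ) 1 := ⟨ha.trans hab, hb.le⟩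
  rw [hω.tail_sub_tail ha' hb', intervalIntegral.integral_of_le hab, setLIntegral_congr Ico_ae_eq_Ioc,
    ofReal_integral_eq_lintegral_ofReal]
  · exact (intervalIntegrable_iff_integrableOn_Ioc_of_le hab).1 (hω.intervalIntegrable ha' hb')
  · filter_upwards [ae_restrict_mem measurableSet_Ioc] with s hs
    exact hω.nonneg_coe (ha.trans hs.1.le) (hs.2.trans_lt hb)

theorem aemeasurable_Ico (hω : IsDoublingWeight ω) {a b : ℝ} (ha : 0 ≤ a) (hab : a ≤ b)
    (hb : b < 1) : AEMeasurable (fun s : ℝ => ENNReal.ofReal (ω (s : ℂ)))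
      (volume.restrict (Set.Ico a b)) := by
  have h := (intervalIntegrable_iff_integrableOn_Ico_of_le hab).1
    (hω.intervalIntegrable (a := a) (b := b) ⟨ha, hab.trans hb.le⟩ ⟨ha.trans hab, hb.le⟩)
  exact h.aestronglyMeasurable.aemeasurable.ennreal_ofReal

theorem tail_antitone (hω : IsDoublingWeight ω) {a b : ℝ} (ha : 0 ≤ a) (hab : a ≤ b)
    (hb : b ≤ 1) : tail ω b ≤ tail ω a := by
  rw [← sub_nonneg, hω.tail_sub_tail ⟨ha, hab.trans hb⟩ ⟨ha.trans hab, hb⟩,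
    intervalIntegral.integral_of_le hab, ← integral_Ico_eq_integral_Ioc]
  exact setIntegral_nonneg measurableSet_Ico fun s hs =>
    hω.nonneg_coe (ha.trans hs.1) (hs.2.trans_le hb)

/-- Each use of doubling halves the distance to `1`, and the tail is decreasing. -/
theorem exists_tail_le_pow_mul (hω : IsDoublingWeight ω) :
    ∃ D : ℝ, 1 ≤ D ∧ ∀ (j : ℕ) (s t : ℝ), 0 ≤ s → s < 1 → 0 ≤ t → t < 1 →
      1 - s ≤ 2 ^ j * (1 - t) → tail ω s ≤ D ^ j * tail ω t := by
  obtain ⟨D, hD, hdoub⟩ := hω.doubling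
  have hiter : ∀ (j : ℕ) (s : ℝ), 0 ≤ s → s < 1 →
      tail ω s ≤ D ^ j * tail ω (1 - (1 - s) / 2 ^ j) := by
    intro j
    induction j with
    | zero => intro s _ _; simp
    | succ j ih =>
      intro s hs hs1
      have h1 := hdoub s hs hs1
      have h2 := ih ((1 + s) / 2) (by linarith) (by linarith)
      have e : 1 - (1 - (1 + s) / 2) / 2 ^ j = 1 - (1 - s) / 2 ^ (j + 1) := by
        field_simp; ring
      rw [e] at h2
      calc tail ω s ≤ D * tail ω ((1 + s) / 2) := h1
        _ ≤ D * (D ^ j * tail ω (1 - (1 - s) / 2 ^ (j + 1))) := by gcongr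
        _ = _ := by ring
  refine ⟨D, hD, fun j s t hs hs1 ht ht1 h => (hiter j s hs hs1).trans ?_⟩
  refine mul_le_mul_of_nonneg_left (hω.tail_antitone ht ?_ ?_) (by positivity)
  · have : (1 - s) / 2 ^ j ≤ 1 - t := by
      rw [div_le_iff₀ (by positivity)]
      linarith
    linarith
  · have : 0 ≤ (1 - s) / 2 ^ j := div_nonneg (by linarith) (by positivity)
    linarith

/-- Finitely many halvings lead from `0` past `x`, so a vanishing tail at `x` would force `tail ω 0
= 0`. -/
theorem tail_pos (hω : IsDoublingWeight ω) (h1 : tail ω 0 = 1) {x : ℝ} (hx : 0 ≤ x)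
    (hx1 : x < 1) : 0 < tail ω x := by
  obtain ⟨D, hD, hdoub⟩ := hω.exists_tail_le_pow_mul
  obtain ⟨j, hj⟩ := pow_unbounded_of_one_lt (1 / (1 - x)) (one_lt_two (α := ℝ))
  have h2 := hdoub j 0 x le_rfl one_pos hx hx1 (by
    rw [div_lt_iff₀ (by linarith)] at hj
    linarith)
  rw [h1] at h2
  exact pos_of_mul_pos_right (one_pos.trans_le h2) (by positivity)

end IsDoublingWeight

/-! ### The dyadic points and blocks -/

/-- The smallest index that belongs to the `n`-th block. -/
def blockStart (r : ℕ → ℝ) (n : ℕ) : ℕ := if n = 0 then 0 else blockIndex r n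

/-- With `0` in place of `M_0` the exceptional block fits the general pattern: the blocks are
consecutive intervals starting at `0`. -/
theorem block_eq_Ico (r : ℕ → ℝ) (n : ℕ) :
    block r n = Finset.Ico (blockStart r n) (blockStart r (n + 1)) := by
  unfold block blockStart
  rcases n with _ | n <;> simp

theorem dyadicBlock_eq_blockPoly (r : ℕ → ℝ) (n : ℕ) (f : ℂ → ℂ) :
    dyadicBlock r n f = blockPoly (taylorCoeff f) (blockStart r n) (blockStart r (n + 1)) := by
  funext z
  rw [dyadicBlock, block_eq_Ico, blockPoly]

namespace IsDyadicPoints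

variable {ω : ℂ → ℝ} {α : ℝ} {r : ℕ → ℝ}

theorem strictMono (hr : IsDyadicPoints ω α r) (hω : IsDoublingWeight ω) (hα : 0 < α) :
    StrictMono r := by
  refine strictMono_nat_of_lt_succ fun n => ?_
  by_contra! h
  have h1 := hω.tail_antitone (hr (n + 1)).1.1 h (hr n).1.2.le
  rw [(hr n).2, (hr (n + 1)).2, Real.rpow_le_rpow_left_iff one_lt_two] at h1
  push_cast at h1
  linarith

theorem pos (hr : IsDyadicPoints ω α r) (hω : IsDoublingWeight ω) (hα : 0 < α) (n : ℕ) :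
    0 < r (n + 1) :=
  (hr 0).1.1.trans_lt (hr.strictMono hω hα (Nat.succ_pos n))

theorem exists_lt (hr : IsDyadicPoints ω α r) (hω : IsDoublingWeight ω) (hα : 0 < α)
    (h1 : tail ω 0 = 1) {x : ℝ} (hx : 0 ≤ x) (hx1 : x < 1) : ∃ n, x < r n := by
  have hlt : (2 : ℝ) ^ (-α) < 1 := Real.rpow_lt_one_of_one_lt_of_neg one_lt_two (by linarith)
  obtain ⟨n, hn⟩ := exists_pow_lt_of_lt_one (hω.tail_pos h1 hx hx1) hlt
  refine ⟨n, ?_⟩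
  by_contra! h
  have h2 := hω.tail_antitone (hr n).1.1 h hx1.le
  rw [(hr n).2, show -(n * α) = -α * n by ring, Real.rpow_mul (by norm_num),
    Real.rpow_natCast] at h2
  linarith

theorem monotone_blockStart (hr : IsDyadicPoints ω α r) (hω : IsDoublingWeight ω) (hα : 0 < α) :
    Monotone (blockStart r) := by
  refine monotone_nat_of_le_succ fun n => ?_
  rcases n with _ | n
  · simp [blockStart]
  · simp only [blockStart, Nat.succ_ne_zero, if_false, blockIndex]
    have h1 := hr.strictMono hω hα (Nat.lt_succ_self (n + 1))
    have h2 := (hr (n + 1 + 1)).1.2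
    exact Nat.floor_mono (one_div_le_one_div_of_le (by linarith) (by linarith))

theorem tendsto_blockStart (hr : IsDyadicPoints ω α r) (hω : IsDoublingWeight ω) (hα : 0 < α)
    (h1 : tail ω 0 = 1) : Filter.Tendsto (blockStart r) Filter.atTop Filter.atTop := by
  refine Filter.tendsto_atTop_atTop_of_monotone (hr.monotone_blockStart hω hα) fun b => ?_
  have hb : (0 : ℝ) < b + 1 := by positivity
  obtain ⟨n, hn⟩ := hr.exists_lt hω hα h1 (x := 1 - 1 / (b + 1)) (by
    rw [sub_nonneg, div_le_one hb]; linarith [(Nat.cast_nonneg b : (0 : ℝ) ≤ b)])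
    (by have : 0 < 1 / ((b : ℝ) + 1) := by positivity
        linarith)
  have hn' := hn.trans (hr.strictMono hω hα (Nat.lt_succ_self n))
  refine ⟨n + 1, ?_⟩
  simp only [blockStart, Nat.succ_ne_zero, if_false, blockIndex]
  have h2 := (hr (n + 1)).1.2
  refine Nat.le_floor ?_
  rw [le_div_iff₀ (by linarith)]
  have h3 : 1 - r (n + 1) ≤ 1 / (b + 1) := by simp only [Nat.succ_eq_add_one] at hn'; linarith
  calc (b : ℝ) * (1 - r (n + 1)) ≤ b * (1 / (b + 1)) := by gcongr
    _ ≤ 1 := by rw [mul_one_div, div_le_one hb]; linarith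

end IsDyadicPoints

/-! ### Interaction between blocks and radii -/

/-- The powers `r_{n+1}^{M_k}` decay faster than any given geometric sequence in `k - n`. -/
theorem exists_pow_blockStart_le {ω : ℂ → ℝ} {α : ℝ} (hω : IsDoublingWeight ω) (hα : 0 < α)
    {σ : ℝ} (hσ : 0 < σ) : ∃ K : ℝ, 1 ≤ K ∧ ∀ r : ℕ → ℝ, IsDyadicPoints ω α r →
      ∀ n k : ℕ, r (n + 1) ^ blockStart r k ≤ K * ((2 : ℝ) ^ (-σ)) ^ (2 * (k - n)) := by
  obtain ⟨D, hD, hdoub⟩ := hω.exists_tail_le_pow_mul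
  -- `N` is the polynomial order of decay in the ratio `R` below that the doubling constant calls
  -- for; it depends on `ω`, `α`, `σ` only. In `K`, the factor `2 ^ (2 * σ)` pays for working with
  -- `i = k - n - 1` instead of `k - n`.
  obtain ⟨N, hN⟩ := pow_unbounded_of_one_lt (D ^ (2 * σ / α)) (one_lt_two (α := ℝ))
  set K : ℝ := Real.exp 1 * N.factorial * 2 ^ N * 2 ^ (2 * σ) with hK
  refine ⟨1 + K, by have : 0 ≤ K := by positivity
                    linarith, fun r hr n k => ?_⟩
  have hmono := hr.strictMono hω hα
  have hx0 := (hr (n + 1)).1.1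
  have hx1 := (hr (n + 1)).1.2
  have hK0 : 0 ≤ K := by positivity
  rcases le_or_gt k n with hkn | hkn
  · rw [Nat.sub_eq_zero_of_le hkn, mul_zero, pow_zero, mul_one]
    exact (pow_le_one₀ hx0 hx1.le).trans (by linarith)
  obtain ⟨i, rfl⟩ := Nat.exists_eq_add_of_lt hkn
  have ht0 := (hr (n + i + 1)).1.1
  have ht1 := (hr (n + i + 1)).1.2
  have hle : r (n + 1) ≤ r (n + i + 1) := hmono.monotone (by omega)
  set x := r (n + 1) with hx
  set t := r (n + i + 1) with ht
  have hst : blockStart r (n + i + 1) = ⌊1 / (1 - t)⌋₊ := by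
    simp [blockStart, blockIndex, ht]
  set R : ℝ := (1 - x) / (1 - t) with hR
  have ht' : 0 < 1 - t := by linarith
  have hR1 : 1 ≤ R := by rw [hR, le_div_iff₀ ht']; linarith
  have hR0 : 0 < R := by linarith
  -- exponential decay
  have hexp : x ^ blockStart r (n + i + 1) ≤ Real.exp 1 * Real.exp (-R) := by
    have h1 : x ≤ Real.exp (-(1 - x)) := by
      have := Real.one_sub_le_exp_neg (1 - x)
      linarith
    have h2 : R - 1 ≤ blockStart r (n + i + 1) * (1 - x) := by
      have h3 : 1 / (1 - t) < blockStart r (n + i + 1) + 1 := by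
        rw [hst]; exact Nat.lt_floor_add_one _
      have h4 : R = (1 / (1 - t)) * (1 - x) := by rw [hR]; ring
      have h5 : (1 / (1 - t)) * (1 - x) ≤ (blockStart r (n + i + 1) + 1) * (1 - x) :=
        mul_le_mul_of_nonneg_right h3.le (by linarith)
      linarith
    calc x ^ blockStart r (n + i + 1) ≤ Real.exp (-(1 - x)) ^ blockStart r (n + i + 1) :=
          pow_le_pow_left₀ hx0 h1 _
      _ = Real.exp (-(blockStart r (n + i + 1) * (1 - x))) := by
          rw [← Real.exp_nat_mul]; ring_nf
      _ ≤ Real.exp (1 + -R) := Real.exp_le_exp.2 (by linarith)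
      _ = _ := Real.exp_add _ _
  have hexp2 : Real.exp (-R) ≤ N.factorial / R ^ N := by
    have h := Real.pow_div_factorial_le_exp R hR0.le N
    rw [Real.exp_neg, inv_le_comm₀ (Real.exp_pos _) (by positivity), inv_div]
    exact h
  -- the doubling property bounds the ratio from below
  have hratio : (2 : ℝ) ^ (2 * σ * i) ≤ 2 ^ N * R ^ N := by
    -- With `2^j ≤ R < 2^{j+1}`, doubling bounds the ratio of the tails, which is exactly `2^{αi}`,
    -- by `D^{j+1}`. Raising this to the power `2σ/α` gives the claim by the choice of `N`.
    obtain ⟨j, hj1, hj2⟩ := exists_nat_pow_near hR1 (one_lt_two (α := ℝ))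
    have h1 := hdoub (j + 1) x t hx0 hx1 ht0 ht1 (by
      rw [hR, div_lt_iff₀ ht'] at hj2
      exact hj2.le)
    rw [(hr (n + 1)).2, (hr (n + i + 1)).2] at h1
    have h2 : (2 : ℝ) ^ (α * i) ≤ D ^ (j + 1) := by
      have h3 : (2 : ℝ) ^ (α * i) =
          2 ^ (-(((n + 1 : ℕ) : ℝ) * α)) * 2 ^ (((n + i + 1 : ℕ) : ℝ) * α) := by
        rw [← Real.rpow_add two_pos]; congr 1; push_cast; ring
      rw [h3]
      calc _ ≤ D ^ (j + 1) * 2 ^ (-(((n + i + 1 : ℕ) : ℝ) * α)) *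
            2 ^ (((n + i + 1 : ℕ) : ℝ) * α) :=
            mul_le_mul_of_nonneg_right h1 (by positivity)
        _ = D ^ (j + 1) := by
            rw [mul_assoc, ← Real.rpow_add two_pos, neg_add_cancel, Real.rpow_zero, mul_one]
    calc (2 : ℝ) ^ (2 * σ * i) = (2 ^ (α * i)) ^ (2 * σ / α) := by
          rw [← Real.rpow_mul two_pos.le]; congr 1; field_simp
      _ ≤ (D ^ (j + 1)) ^ (2 * σ / α) := Real.rpow_le_rpow (by positivity) h2 (by positivity)
      _ = (D ^ (2 * σ / α)) ^ (j + 1) := by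
          rw [← Real.rpow_natCast, ← Real.rpow_natCast, ← Real.rpow_mul (by linarith),
            ← Real.rpow_mul (by linarith), mul_comm]
      _ ≤ (2 ^ N) ^ (j + 1) := pow_le_pow_left₀ (by positivity) hN.le _
      _ = 2 ^ N * (2 ^ j) ^ N := by rw [pow_succ, ← pow_mul, ← pow_mul, mul_comm N j, mul_comm]
      _ ≤ 2 ^ N * R ^ N := by gcongr
  have hpow : ((2 : ℝ) ^ (-σ)) ^ (2 * (n + i + 1 - n)) = (2 ^ (2 * σ))⁻¹ * (2 ^ (2 * σ * i))⁻¹ := by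
    rw [← Real.rpow_natCast, ← Real.rpow_mul two_pos.le, ← Real.rpow_neg two_pos.le,
      ← Real.rpow_neg two_pos.le, ← Real.rpow_add two_pos, show n + i + 1 - n = i + 1 by omega]
    congr 1
    push_cast
    ring
  have hinv : (R ^ N)⁻¹ ≤ 2 ^ N * (2 ^ (2 * σ * i))⁻¹ := by
    rw [inv_eq_one_div, div_le_iff₀ (by positivity), mul_right_comm, ← div_eq_mul_inv,
      one_le_div (by positivity)]
    exact hratio
  calc x ^ blockStart r (n + i + 1) ≤ Real.exp 1 * (N.factorial / R ^ N) :=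
        hexp.trans (mul_le_mul_of_nonneg_left hexp2 (Real.exp_pos _).le)
    _ = Real.exp 1 * N.factorial * (R ^ N)⁻¹ := by ring
    _ ≤ Real.exp 1 * N.factorial * (2 ^ N * (2 ^ (2 * σ * i))⁻¹) := by gcongr
    _ = K * ((2 ^ (2 * σ))⁻¹ * (2 ^ (2 * σ * i))⁻¹) := by rw [hK]; field_simp
    _ ≤ (1 + K) * ((2 ^ (2 * σ))⁻¹ * (2 ^ (2 * σ * i))⁻¹) := by
        gcongr; linarith
    _ = _ := by rw [hpow]

/-- The means at `r_{n+1}` are controlled by a discrete convolution of the block norms. -/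
theorem exists_integralMean_le_tsum_hardyNorm {p α : ℝ} (hp : 1 < p) (hα : 0 < α) {ω : ℂ → ℝ}
    (hω : IsDoublingWeight ω) (h1 : tail ω 0 = 1) {σ : ℝ} (hσ : 0 < σ) :
    ∃ K : ℝ≥0∞, K ≠ ∞ ∧ ∀ r : ℕ → ℝ, IsDyadicPoints ω α r → ∀ f : ℂ → ℂ, IsAnalyticDisc f →
      ∀ n : ℕ, ENNReal.ofReal (2 ^ (-σ)) ^ n * integralMean p (r (n + 1)) f ≤
        K * ∑' k, ENNReal.ofReal (2 ^ (-σ)) ^ Nat.dist n k *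
          (ENNReal.ofReal (2 ^ (-σ)) ^ k * hardyNorm p (dyadicBlock r k f)) := by
  have hp0 : 0 < p := by linarith
  obtain ⟨K, hK1, hK⟩ := exists_pow_blockStart_le hω hα hσ
  refine ⟨ENNReal.ofReal K, ENNReal.ofReal_ne_top, fun r hr f hf n => ?_⟩
  set d : ℝ≥0∞ := ENNReal.ofReal (2 ^ (-σ)) with hd
  have hx0 := (hr (n + 1)).1.1
  have hx1 := (hr (n + 1)).1.2
  refine (mul_le_mul_right (integralMean_le_tsum hp.le hf (hr.monotone_blockStart hω hα)
    (by simp [blockStart]) (hr.tendsto_blockStart hω hα h1) hx0 hx1) _).trans ?_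
  rw [← ENNReal.tsum_mul_left, ← ENNReal.tsum_mul_left]
  refine ENNReal.tsum_le_tsum fun k => ?_
  rw [dyadicBlock_eq_blockPoly]
  refine (mul_le_mul_right (integralMean_blockPoly_le hp0 _ _ _ hx0 hx1.le) _).trans ?_
  have h2 : ENNReal.ofReal (r (n + 1) ^ blockStart r k) ≤ ENNReal.ofReal K * d ^ (2 * (k - n)) := by
    rw [hd, ← ENNReal.ofReal_pow (by positivity), ← ENNReal.ofReal_mul (by linarith)]
    exact ENNReal.ofReal_le_ofReal (hK r hr n k)
  -- This is why the decay was proved with exponent `2(k - n)`: for `k > n` one half turns the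
  -- weight `d^n` into `d^k`, and the other half is the convolution kernel. For `k ≤ n` the
  -- truncated difference is `0`, and `d^n` already splits as needed.
  have h3 : n + 2 * (k - n) = Nat.dist n k + k := by
    unfold Nat.dist; omega
  generalize hardyNorm p (blockPoly _ _ _) = H
  calc d ^ n * (ENNReal.ofReal (r (n + 1) ^ blockStart r k) * H)
      ≤ d ^ n * (ENNReal.ofReal K * d ^ (2 * (k - n)) * H) := by gcongr
    _ = ENNReal.ofReal K * (d ^ (n + 2 * (k - n)) * H) := by rw [pow_add]; ring
    _ = _ := by rw [h3, pow_add]; ring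

/-- Since `N - 1 ≤ x/(1-x)` and `1/x - 1 = (1-x)/x`, the product is at most `1`. The exponent is the
degree `N - 1`; with `N` the bound would fail as `x → 0`. -/
theorem inv_pow_floor_sub_one_le {x : ℝ} (hx : 0 < x) (hx1 : x < 1) :
    (x ^ (⌊1 / (1 - x)⌋₊ - 1))⁻¹ ≤ Real.exp 1 := by
  have h1 : 0 < 1 - x := by linarith
  set N := ⌊1 / (1 - x)⌋₊ with hN
  have hN1 : 1 ≤ N := Nat.le_floor (by
    rw [Nat.cast_one, le_div_iff₀ h1]; linarith)
  have hN2 : (N : ℝ) ≤ 1 / (1 - x) := Nat.floor_le (by positivity)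
  have hinv : x⁻¹ ≤ Real.exp (x⁻¹ - 1) := by
    have := Real.add_one_le_exp (x⁻¹ - 1)
    linarith
  have h2 : ((N - 1 : ℕ) : ℝ) * (x⁻¹ - 1) ≤ 1 := by
    rw [Nat.cast_sub hN1, Nat.cast_one]
    have h3 : 0 ≤ x⁻¹ - 1 := sub_nonneg.2 ((one_le_inv₀ hx).2 hx1.le)
    calc ((N : ℝ) - 1) * (x⁻¹ - 1) ≤ (1 / (1 - x) - 1) * (x⁻¹ - 1) := by gcongr
      _ = 1 := by field_simp; ring
  rw [← inv_pow]
  calc x⁻¹ ^ (N - 1) ≤ Real.exp (x⁻¹ - 1) ^ (N - 1) := pow_le_pow_left₀ (by positivity) hinv _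
    _ = Real.exp ((N - 1 : ℕ) * (x⁻¹ - 1)) := (Real.exp_nat_mul _ _).symm
    _ ≤ Real.exp 1 := Real.exp_le_exp.2 h2

/-- The norm of the `n`-th block is controlled by the mean at `r_{n+1}`. -/
theorem exists_hardyNorm_dyadicBlock_le {p : ℝ} (hp : 1 < p) :
    ∃ C : ℝ≥0∞, C ≠ ∞ ∧ ∀ (ω : ℂ → ℝ) (α : ℝ), IsDoublingWeight ω → 0 < α →
      ∀ r : ℕ → ℝ, IsDyadicPoints ω α r → ∀ f : ℂ → ℂ, IsAnalyticDisc f → ∀ n : ℕ,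
        hardyNorm p (dyadicBlock r n f) ≤ C * integralMean p (r (n + 1)) f := by
  have hp0 : 0 < p := by linarith
  obtain ⟨C, hC, hR⟩ := exists_integralMean_blockPoly_le hp
  refine ⟨ENNReal.ofReal (Real.exp 1) * ENNReal.ofReal C,
    ENNReal.mul_ne_top ENNReal.ofReal_ne_top ENNReal.ofReal_ne_top,
    fun ω α hω hα r hr f hf n => ?_⟩
  have hx0 := hr.pos hω hα n
  have hx1 := (hr (n + 1)).1.2
  rw [dyadicBlock_eq_blockPoly, mul_assoc]
  refine (hardyNorm_blockPoly_le hp0 _ _ _ hx0 hx1.le).trans (mul_le_mul' ?_ ?_)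
  · refine ENNReal.ofReal_le_ofReal ?_
    simpa [blockStart, blockIndex] using inv_pow_floor_sub_one_le hx0 hx1
  · exact hR f hf _ hx0.le hx1 _ _ (hr.monotone_blockStart hω hα (Nat.le_succ n))

/-! ### Comparison of the norms -/

section Comparison

variable {p α : ℝ} {ω : ℂ → ℝ}

theorem ofReal_two_rpow_neg_lt_one {σ : ℝ} (hσ : 0 < σ) : ENNReal.ofReal ((2 : ℝ) ^ (-σ)) < 1 :=
  ENNReal.ofReal_lt_one.2 (Real.rpow_lt_one_of_one_lt_of_neg one_lt_two (by linarith))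

theorem ofReal_two_rpow_neg_pow (σ : ℝ) (n : ℕ) :
    ENNReal.ofReal ((2 : ℝ) ^ (-σ)) ^ n = ENNReal.ofReal (2 ^ (-(n * σ))) := by
  rw [← ENNReal.ofReal_pow (by positivity), ← Real.rpow_natCast, ← Real.rpow_mul two_pos.le]
  ring_nf

theorem ofReal_two_rpow_neg_pow_rpow (α : ℝ) {q : ℝ} (hq : 0 < q) (n : ℕ) :
    (ENNReal.ofReal ((2 : ℝ) ^ (-(α / q))) ^ n) ^ q = ENNReal.ofReal (2 ^ (-(n * α))) := by
  rw [ofReal_two_rpow_neg_pow, ENNReal.ofReal_rpow_of_nonneg (by positivity) hq.le,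
    ← Real.rpow_mul two_pos.le]
  congr 2
  field_simp

theorem IsDyadicPoints.lintegral_le {r : ℕ → ℝ} (hr : IsDyadicPoints ω α r) (hp : 0 < p)
    (hα : 0 < α) (hω : IsDoublingWeight ω) (h1 : tail ω 0 = 1) {q : ℝ} (hq : 0 < q)
    {f : ℂ → ℂ} (hf : IsAnalyticDisc f) :
    ∫⁻ x in Set.Ioo (0 : ℝ) 1, integralMean p x f ^ q * ENNReal.ofReal (ω (x : ℂ)) ≤
      ∑' n : ℕ, ENNReal.ofReal (2 ^ (-(n * α))) * integralMean p (r (n + 1)) f ^ q := by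
  have hmono := hr.strictMono hω hα
  -- `r_0` may be positive when `ω` vanishes almost everywhere near `0`. Starting from `0` instead
  -- covers the whole interval without changing the tail.
  set ρ : ℕ → ℝ := fun n => if n = 0 then 0 else r n with hρ
  have hρ0 : ∀ n, 0 ≤ ρ n := by
    intro n
    simp only [hρ]
    split_ifs
    · exact le_rfl
    · exact (hr n).1.1
  have hρle : ∀ n, ρ n ≤ r n := by
    intro n
    simp only [hρ]
    split_ifs
    · exact (hr n).1.1
    · exact le_rfl
  have hρt : ∀ n : ℕ, tail ω (ρ n) = 2 ^ (-(n * α)) := by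
    intro n
    simp only [hρ]
    split_ifs with h
    · simp [h, h1]
    · exact (hr n).2
  have hcover : Set.Ioo (0 : ℝ) 1 ⊆ ⋃ n : ℕ, Set.Ico (ρ n) (r (n + 1)) := by
    intro x hx
    have hex : ∃ n, x < r (n + 1) := by
      obtain ⟨n, hn⟩ := hr.exists_lt hω hα h1 hx.1.le hx.2
      exact ⟨n, hn.trans (hmono (Nat.lt_succ_self n))⟩
    classical
    refine Set.mem_iUnion.2 ⟨Nat.find hex, ?_, Nat.find_spec hex⟩
    rcases h : Nat.find hex with _ | n
    · simpa [hρ] using hx.1.le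
    · have := Nat.find_min hex (m := n) (by omega)
      simpa [hρ] using this
  refine (lintegral_mono_set hcover).trans ((lintegral_iUnion_le _ _).trans
    (ENNReal.tsum_le_tsum fun n => ?_))
  have hle : ρ n ≤ r (n + 1) := (hρle n).trans (hmono.monotone (Nat.le_succ n))
  have hlt := (hr (n + 1)).1.2
  -- On each interval the mean is replaced by its value at an endpoint, so only the weight has to be
  -- measurable.
  calc ∫⁻ x in Set.Ico (ρ n) (r (n + 1)), integralMean p x f ^ q * ENNReal.ofReal (ω (x : ℂ))
      ≤ ∫⁻ x in Set.Ico (ρ n) (r (n + 1)),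
          integralMean p (r (n + 1)) f ^ q * ENNReal.ofReal (ω (x : ℂ)) := by
        refine setLIntegral_mono' measurableSet_Ico fun x hx => ?_
        gcongr
        exact integralMean_mono hp hf ((hρ0 n).trans hx.1) hx.2.le hlt
    _ = integralMean p (r (n + 1)) f ^ q * ENNReal.ofReal (tail ω (ρ n) - tail ω (r (n + 1))) := by
        rw [lintegral_const_mul'' _ (hω.aemeasurable_Ico (hρ0 n) hle hlt),
          hω.lintegral_Ico (hρ0 n) hle hlt]
    _ ≤ integralMean p (r (n + 1)) f ^ q * ENNReal.ofReal (2 ^ (-(n * α))) := by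
        gcongr
        rw [hρt, (hr (n + 1)).2]
        have : (0 : ℝ) < 2 ^ (-(((n + 1 : ℕ) : ℝ) * α)) := by positivity
        linarith
    _ = _ := mul_comm _ _

theorem IsDyadicPoints.tsum_le_lintegral {r : ℕ → ℝ} (hr : IsDyadicPoints ω α r) (hp : 0 < p)
    (hα : 0 < α) (hω : IsDoublingWeight ω) {q : ℝ} (hq : 0 < q)
    {f : ℂ → ℂ} (hf : IsAnalyticDisc f) :
    ENNReal.ofReal (2 ^ (-α) - 2 ^ (-(2 * α))) *
      ∑' n : ℕ, ENNReal.ofReal (2 ^ (-(n * α))) * integralMean p (r (n + 1)) f ^ q ≤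
    ∫⁻ x in Set.Ioo (0 : ℝ) 1, integralMean p x f ^ q * ENNReal.ofReal (ω (x : ℂ)) := by
  have hmono := hr.strictMono hω hα
  -- The value at `r_{n+1}` bounds the means from below on the next interval, `[r_{n+1}, r_{n+2})`,
  -- whose mass is `2^{-nα} (2^{-α} - 2^{-2α})`.
  have hdisj : Pairwise (Function.onFun Disjoint
      fun n : ℕ => Set.Ico (r (n + 1)) (r (n + 1 + 1))) :=
    (hmono.monotone.comp (fun _ _ h => Nat.succ_le_succ h :
      Monotone Nat.succ)).pairwise_disjoint_on_Ico_succ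
  have hsub : (⋃ n : ℕ, Set.Ico (r (n + 1)) (r (n + 1 + 1))) ⊆ Set.Ioo (0 : ℝ) 1 :=
    Set.iUnion_subset fun n x hx =>
      ⟨(hr.pos hω hα n).trans_le hx.1, hx.2.trans (hr (n + 1 + 1)).1.2⟩
  refine le_trans ?_ (lintegral_mono_set hsub)
  rw [lintegral_iUnion (fun n => measurableSet_Ico) hdisj, ← ENNReal.tsum_mul_left]
  refine ENNReal.tsum_le_tsum fun n => ?_
  have h0 := (hr (n + 1)).1.1
  have hle : r (n + 1) ≤ r (n + 1 + 1) := hmono.monotone (Nat.le_succ _)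
  have hlt := (hr (n + 1 + 1)).1.2
  calc ENNReal.ofReal (2 ^ (-α) - 2 ^ (-(2 * α))) *
        (ENNReal.ofReal (2 ^ (-(n * α))) * integralMean p (r (n + 1)) f ^ q)
      = integralMean p (r (n + 1)) f ^ q *
          ENNReal.ofReal (tail ω (r (n + 1)) - tail ω (r (n + 1 + 1))) := by
        rw [← mul_assoc, mul_comm, ← ENNReal.ofReal_mul' (by positivity), (hr (n + 1)).2,
          (hr (n + 1 + 1)).2, sub_mul, ← Real.rpow_add two_pos, ← Real.rpow_add two_pos]
        congr 4 <;> (push_cast; ring)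
    _ = ∫⁻ x in Set.Ico (r (n + 1)) (r (n + 1 + 1)),
          integralMean p (r (n + 1)) f ^ q * ENNReal.ofReal (ω (x : ℂ)) := by
        rw [lintegral_const_mul'' _ (hω.aemeasurable_Ico h0 hle hlt), hω.lintegral_Ico h0 hle hlt]
    _ ≤ _ := by
        refine setLIntegral_mono' measurableSet_Ico fun x hx => ?_
        gcongr
        exact integralMean_mono hp hf h0 hx.1 (hx.2.trans hlt)

theorem exists_mixedNorm_le_blockSum (hp : 1 < p) (hα : 0 < α) (hω : IsDoublingWeight ω)
    (h1 : tail ω 0 = 1) {q : ℝ} (hq : 0 < q) :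
    ∃ C : ℝ≥0∞, C ≠ ∞ ∧ ∀ r : ℕ → ℝ, IsDyadicPoints ω α r → ∀ f : ℂ → ℂ, IsAnalyticDisc f →
      mixedNorm p q ω f ≤ C * blockSum p q α r f ^ (1 / q) := by
  have hp0 : 0 < p := by linarith
  -- With `σ = α/q` the `q`-th power of `2^{-σn}` is the weight `2^{-nα}`.
  have hσ : 0 < α / q := by positivity
  obtain ⟨K, hK, hKle⟩ := exists_integralMean_le_tsum_hardyNorm hp hα hω h1 hσ
  obtain ⟨B, hB, hBle⟩ := exists_tsum_tsum_pow_dist_rpow_le hq (ofReal_two_rpow_neg_lt_one hσ)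
  refine ⟨(K ^ q * B) ^ (1 / q), ENNReal.rpow_ne_top_of_nonneg (by positivity)
    (ENNReal.mul_ne_top (ENNReal.rpow_ne_top_of_nonneg hq.le hK) hB), fun r hr f hf => ?_⟩
  rw [← ENNReal.mul_rpow_of_nonneg _ _ (by positivity)]
  refine ENNReal.rpow_le_rpow ?_ (by positivity)
  refine (hr.lintegral_le hp0 hα hω h1 hq hf).trans ?_
  set d := ENNReal.ofReal ((2 : ℝ) ^ (-(α / q))) with hd
  calc ∑' n : ℕ, ENNReal.ofReal (2 ^ (-(n * α))) * integralMean p (r (n + 1)) f ^ q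
      ≤ ∑' n : ℕ, K ^ q * (∑' k, d ^ Nat.dist n k *
          (d ^ k * hardyNorm p (dyadicBlock r k f))) ^ q := by
        refine ENNReal.tsum_le_tsum fun n => ?_
        rw [← ofReal_two_rpow_neg_pow_rpow α hq, ← ENNReal.mul_rpow_of_nonneg _ _ hq.le,
          ← ENNReal.mul_rpow_of_nonneg _ _ hq.le]
        exact ENNReal.rpow_le_rpow (hKle r hr f hf n) hq.le
    _ ≤ K ^ q * (B * ∑' k, (d ^ k * hardyNorm p (dyadicBlock r k f)) ^ q) := by
        rw [ENNReal.tsum_mul_left]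
        exact mul_le_mul_right (hBle _) _
    _ = K ^ q * B * blockSum p q α r f := by
        rw [mul_assoc, blockSum]
        simp only [ENNReal.mul_rpow_of_nonneg _ _ hq.le, hd, ofReal_two_rpow_neg_pow_rpow α hq]

theorem exists_blockSum_le_mixedNorm (hp : 1 < p) (hα : 0 < α) (hω : IsDoublingWeight ω)
    {q : ℝ} (hq : 0 < q) :
    ∃ C : ℝ≥0∞, C ≠ ∞ ∧ ∀ r : ℕ → ℝ, IsDyadicPoints ω α r → ∀ f : ℂ → ℂ, IsAnalyticDisc f →
      blockSum p q α r f ^ (1 / q) ≤ C * mixedNorm p q ω f := by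
  have hp0 : 0 < p := by linarith
  obtain ⟨B, hB, hBle⟩ := exists_hardyNorm_dyadicBlock_le hp
  set c := ENNReal.ofReal ((2 : ℝ) ^ (-α) - 2 ^ (-(2 * α))) with hc
  have hc0 : c ≠ 0 := by
    refine (ENNReal.ofReal_pos.2 (sub_pos.2 ?_)).ne'
    exact (Real.rpow_lt_rpow_left_iff one_lt_two).2 (by linarith)
  have hct : c ≠ ∞ := ENNReal.ofReal_ne_top
  refine ⟨(B ^ q * c⁻¹) ^ (1 / q), ENNReal.rpow_ne_top_of_nonneg (by positivity)
    (ENNReal.mul_ne_top (ENNReal.rpow_ne_top_of_nonneg hq.le hB) (ENNReal.inv_ne_top.2 hc0)),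
    fun r hr f hf => ?_⟩
  rw [mixedNorm, ← ENNReal.mul_rpow_of_nonneg _ _ (by positivity)]
  refine ENNReal.rpow_le_rpow ?_ (by positivity)
  set S := ∑' n : ℕ, ENNReal.ofReal (2 ^ (-(n * α))) * integralMean p (r (n + 1)) f ^ q with hS
  calc blockSum p q α r f ≤ B ^ q * S := by
        rw [hS, ← ENNReal.tsum_mul_left]
        refine ENNReal.tsum_le_tsum fun n => ?_
        rw [mul_left_comm, ← ENNReal.mul_rpow_of_nonneg _ _ hq.le]
        gcongr
        exact hBle ω α hω hα r hr f hf n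
    _ = B ^ q * c⁻¹ * (c * S) := by
        rw [mul_assoc, ← mul_assoc c⁻¹, ENNReal.inv_mul_cancel hc0 hct, one_mul]
    _ ≤ _ := mul_le_mul_right (hr.tsum_le_lintegral hp0 hα hω hq hf) _

theorem exists_mixedSupNorm_le_blockSup (hp : 1 < p) (hα : 0 < α) (hω : IsDoublingWeight ω)
    (h1 : tail ω 0 = 1) {β : ℝ} (hβ : 0 < β) :
    ∃ C : ℝ≥0∞, C ≠ ∞ ∧ ∀ r : ℕ → ℝ, IsDyadicPoints ω α r → ∀ f : ℂ → ℂ, IsAnalyticDisc f →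
      mixedSupNorm p β ω f ≤ C * blockSup p α β r f := by
  have hp0 : 0 < p := by linarith
  have hσ : 0 < α * β := by positivity
  obtain ⟨K, hK, hKle⟩ := exists_integralMean_le_tsum_hardyNorm hp hα hω h1 hσ
  set d := ENNReal.ofReal ((2 : ℝ) ^ (-(α * β))) with hd
  have hd1 : d < 1 := ofReal_two_rpow_neg_lt_one hσ
  refine ⟨K * (2 * (1 - d)⁻¹), ENNReal.mul_ne_top hK (ENNReal.mul_ne_top (by simp)
    (ENNReal.inv_ne_top.2 (tsub_pos_of_lt hd1).ne')), fun r hr f hf => iSup₂_le fun x hx => ?_⟩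
  have hmono := hr.strictMono hω hα
  have hex : ∃ n, x < r (n + 1) := by
    obtain ⟨n, hn⟩ := hr.exists_lt hω hα h1 hx.1.le hx.2
    exact ⟨n, hn.trans (hmono (Nat.lt_succ_self n))⟩
  -- The least `n` with `x < r_{n+1}`: minimality gives `r_n ≤ x` for `n ≥ 1`, and for `n = 0` the
  -- bound is `tail ω 0 = 1`.
  obtain ⟨n, hn, htail⟩ : ∃ n, x < r (n + 1) ∧ tail ω x ≤ 2 ^ (-(n * α)) := by
    classical
    refine ⟨Nat.find hex, Nat.find_spec hex, ?_⟩
    rcases h : Nat.find hex with _ | n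
    · simpa [h1] using hω.tail_antitone le_rfl hx.1.le hx.2.le
    · have := not_lt.1 (Nat.find_min hex (m := n) (by omega))
      rw [← (hr (n + 1)).2]
      exact hω.tail_antitone (hr (n + 1)).1.1 this hx.2.le
  have hdn : ENNReal.ofReal (tail ω x ^ β) ≤ d ^ n := by
    rw [hd, ofReal_two_rpow_neg_pow, ← mul_assoc]
    refine ENNReal.ofReal_le_ofReal ?_
    rw [← neg_mul, Real.rpow_mul two_pos.le]
    exact Real.rpow_le_rpow (hω.tail_pos h1 hx.1.le hx.2).le htail hβ.le
  calc integralMean p x f * ENNReal.ofReal (tail ω x ^ β)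
      ≤ integralMean p (r (n + 1)) f * d ^ n :=
        mul_le_mul' (integralMean_mono hp0 hf hx.1.le hn.le (hr (n + 1)).1.2) hdn
    _ = d ^ n * integralMean p (r (n + 1)) f := mul_comm _ _
    _ ≤ K * ∑' k, d ^ Nat.dist n k * (d ^ k * hardyNorm p (dyadicBlock r k f)) :=
        hKle r hr f hf n
    _ ≤ K * ∑' k, d ^ Nat.dist n k * blockSup p α β r f := by
        gcongr with k
        rw [hd, ofReal_two_rpow_neg_pow, ← mul_assoc]
        exact le_iSup (fun k : ℕ => ENNReal.ofReal ((2 : ℝ) ^ (-(k * α * β))) *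
          hardyNorm p (dyadicBlock r k f)) k
    _ ≤ K * (2 * (1 - d)⁻¹) * blockSup p α β r f := by
        rw [ENNReal.tsum_mul_right, mul_assoc]
        gcongr
        simp only [Nat.dist_comm n]
        exact tsum_pow_dist_le d n

theorem exists_blockSup_le_mixedSupNorm (hp : 1 < p) (hα : 0 < α) (hω : IsDoublingWeight ω)
    (β : ℝ) :
    ∃ C : ℝ≥0∞, C ≠ ∞ ∧ ∀ r : ℕ → ℝ, IsDyadicPoints ω α r → ∀ f : ℂ → ℂ, IsAnalyticDisc f →
      blockSup p α β r f ≤ C * mixedSupNorm p β ω f := by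
  obtain ⟨B, hB, hBle⟩ := exists_hardyNorm_dyadicBlock_le hp
  set d := ENNReal.ofReal ((2 : ℝ) ^ (-(α * β))) with hd
  have hd0 : d ≠ 0 := (ENNReal.ofReal_pos.2 (by positivity)).ne'
  have hdt : d ≠ ∞ := ENNReal.ofReal_ne_top
  refine ⟨B * d⁻¹, ENNReal.mul_ne_top hB (ENNReal.inv_ne_top.2 hd0), fun r hr f hf =>
    iSup_le fun n => ?_⟩
  have hx0 := hr.pos hω hα n
  have hx1 := (hr (n + 1)).1.2
  -- The mean is tested at `r_{n+1}` while the block carries the weight of index `n`; the mismatch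
  -- is the factor `d⁻¹` in the constant.
  have htail : ENNReal.ofReal (tail ω (r (n + 1)) ^ β) = d ^ (n + 1) := by
    rw [hd, ofReal_two_rpow_neg_pow, (hr (n + 1)).2, ← Real.rpow_mul two_pos.le, neg_mul, mul_assoc]
  have hdn : ENNReal.ofReal ((2 : ℝ) ^ (-(n * α * β))) = d ^ n := by
    rw [hd, ofReal_two_rpow_neg_pow, mul_assoc]
  calc ENNReal.ofReal ((2 : ℝ) ^ (-(n * α * β))) * hardyNorm p (dyadicBlock r n f)
      ≤ d ^ n * (B * integralMean p (r (n + 1)) f) := by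
        rw [hdn]
        gcongr
        exact hBle ω α hω hα r hr f hf n
    _ = B * d⁻¹ * (integralMean p (r (n + 1)) f * d ^ (n + 1)) := by
        rw [pow_succ]
        calc d ^ n * (B * integralMean p (r (n + 1)) f)
            = B * (integralMean p (r (n + 1)) f * d ^ n) * 1 := by ring
          _ = B * (integralMean p (r (n + 1)) f * d ^ n) * (d⁻¹ * d) := by
              rw [ENNReal.inv_mul_cancel hd0 hdt]
          _ = _ := by ring
    _ ≤ B * d⁻¹ * mixedSupNorm p β ω f := by
        gcongr
        rw [← htail]
        exact le_iSup₂_of_le (f := fun x (_ : x ∈ Set.Ioo (0 : ℝ) 1) =>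
          integralMean p x f * ENNReal.ofReal (tail ω x ^ β)) (r (n + 1)) ⟨hx0, hx1⟩ le_rfl

end Comparison

/-- Two one-sided bounds with finite constants give a common positive real constant. -/
theorem exists_common_bound {A B : ℝ≥0∞} (hA : A ≠ ∞) (hB : B ≠ ∞) :
    ∃ C : ℝ≥0, 0 < C ∧ A ≤ C ∧ B ≤ C := by
  refine ⟨A.toNNReal + B.toNNReal + 1, by positivity, ?_, ?_⟩
  · rw [← ENNReal.coe_toNNReal hA, ENNReal.coe_le_coe, ENNReal.toNNReal_coe]
    exact le_self_add.trans (le_self_add)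
  · rw [← ENNReal.coe_toNNReal hB, ENNReal.coe_le_coe, ENNReal.toNNReal_coe]
    exact le_add_self.trans (le_self_add)

end MixedNorm

end

theorem theorem3p4 (p α : ℝ) (hp : 1 < p) (hα : 0 < α) (ω : ℂ → ℝ)
    (hω : MixedNorm.IsDoublingWeight ω) (hω1 : ∫ s in (0 : ℝ)..1, ω (s : ℂ) = 1) :
    (∀ q : ℝ, 0 < q → ∃ C : ℝ≥0, 0 < C ∧
      ∀ r : ℕ → ℝ, MixedNorm.IsDyadicPoints ω α r →
      ∀ f : ℂ → ℂ, MixedNorm.IsAnalyticDisc f →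
        (f ∈ MixedNorm.MixedNormSpace p q ω ↔ MixedNorm.blockSum p q α r f < ∞) ∧
        MixedNorm.mixedNorm p q ω f ≤ C * MixedNorm.blockSum p q α r f ^ (1 / q) ∧
        MixedNorm.blockSum p q α r f ^ (1 / q) ≤ C * MixedNorm.mixedNorm p q ω f) ∧
    (∀ β : ℝ, 0 < β → ∃ C : ℝ≥0, 0 < C ∧
      ∀ r : ℕ → ℝ, MixedNorm.IsDyadicPoints ω α r →
      ∀ f : ℂ → ℂ, MixedNorm.IsAnalyticDisc f →
        (f ∈ MixedNorm.MixedSupNormSpace p β ω ↔ MixedNorm.blockSup p α β r f < ∞) ∧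
        MixedNorm.mixedSupNorm p β ω f ≤ C * MixedNorm.blockSup p α β r f ∧
        MixedNorm.blockSup p α β r f ≤ C * MixedNorm.mixedSupNorm p β ω f) := by
  constructor
  · intro q hq
    obtain ⟨A, hA, hAle⟩ := MixedNorm.exists_mixedNorm_le_blockSum hp hα hω hω1 hq
    obtain ⟨B, hB, hBle⟩ := MixedNorm.exists_blockSum_le_mixedNorm hp hα hω hq
    obtain ⟨C, hC, hAC, hBC⟩ := MixedNorm.exists_common_bound hA hB
    refine ⟨C, hC, fun r hr f hf => ?_⟩
    have h1 := (hAle r hr f hf).trans (mul_le_mul_left hAC _)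
    have h2 := (hBle r hr f hf).trans (mul_le_mul_left hBC _)
    refine ⟨⟨fun h => ?_, fun h => ⟨hf, ?_⟩⟩, h1, h2⟩
    · exact (ENNReal.rpow_lt_top_iff_of_pos (by positivity)).1
        (h2.trans_lt (ENNReal.mul_lt_top ENNReal.coe_lt_top h.2))
    · exact h1.trans_lt (ENNReal.mul_lt_top ENNReal.coe_lt_top
        (ENNReal.rpow_lt_top_of_nonneg (by positivity) h.ne))
  · intro β hβ
    obtain ⟨A, hA, hAle⟩ := MixedNorm.exists_mixedSupNorm_le_blockSup hp hα hω hω1 hβ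
    obtain ⟨B, hB, hBle⟩ := MixedNorm.exists_blockSup_le_mixedSupNorm hp hα hω β
    obtain ⟨C, hC, hAC, hBC⟩ := MixedNorm.exists_common_bound hA hB
    refine ⟨C, hC, fun r hr f hf => ?_⟩
    have h1 := (hAle r hr f hf).trans (mul_le_mul_left hAC _)
    have h2 := (hBle r hr f hf).trans (mul_le_mul_left hBC _)
    exact ⟨⟨fun h => h2.trans_lt (ENNReal.mul_lt_top ENNReal.coe_lt_top h.2),
      fun h => ⟨hf, h1.trans_lt (ENNReal.mul_lt_top ENNReal.coe_lt_top h)⟩⟩, h1, h2⟩
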